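/- **Setting.** There are $n\ge 2$ prisoners and $r\ge 2$ rooms; each room has $s=2$ lightswitches, hence four configurations, which we name $0$ (both switches off), $1$, $\mathrm{up}$ and $\mathrm{done}$. All rooms start in configuration $0$ and are indistinguishable except for their configurations. A schedule is an infinite sequence of visits, each of one prisoner to one room; it is valid if every prisoner visits every room infinitely often. During a visit the prisoner learns only the current configuration of the room, and may change it. A protocol assigns to each prisoner a deterministic strategy; it is *winning* if under every valid schedule some prisoner eventually declares, and at the time of the first declaration every prisoner has visited every room. Algorithms are sequences of commands, executed in order, at most one FLIP or SEE per visit. FLIP$(a,b)$: wait until you see a room in configuration $a$, then reconfigure it to $b$. SEE$(a)$: wait until you see a room in configuration $a$. DECLARE: declare as soon as this command is reached. **Protocol.** One prisoner is the leader. There are $r-1$ rounds $k=0,1,\dots,r-2$. Put $(a_k,b_k)=(0,1)$ if $k$ is even (a "$0$-phase") and $(a_k,b_k)=(1,0)$ if $k$ is odd (a "$1$-phase"). *Leader*, for $k=0,\dots,r-2$ in order: FLIP$(a_k,\mathrm{up})$; then $n-2$ times FLIP$(b_k,\mathrm{up})$; then FLIP$(b_k,\mathrm{done})$; then $r-(k+1)$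 times FLIP$(a_k,b_k)$ (the *transition* after round $k$). After the last round: DECLARE. *Every other prisoner*, for $k=0,\dots,r-2$ in order: $n$ times [SEE$(a_k)$; SEE$(\mathrm{up})$]; then FLIP$(\mathrm{up},b_k)$. (For odd $r$ this is $(r-1)/2$ repetitions of a $0$-phase round followed by a $1$-phase round; for even $r$ it is $(r-2)/2$ such repetitions followed by one more $0$-phase round.) The *phase* of round $k$ is the time during which the leader's current command is one of the commands FLIP$(b_k,\mathrm{up})$ or FLIP$(b_k,\mathrm{done})$ of round $k$. **Theorem.** For all $n\ge2$, $r\ge 2$ and every choice of the leader, this protocol is winning. Moreover, under every valid schedule there are distinct rooms $A_0,\dots,A_{r-2}$ (the active rooms) such that for every round $k$: 1. Throughout the phase of round $k$, room $A_k$ is in configuration $b_k$ or $\mathrm{up}$, the rooms $A_j$ with $j<k$ are in configuration $\mathrm{done}$, and all other rooms are in configuration $a_k$. When the phase starts, $A_k$ is in configuration $\mathrm{up}$. 2. During the phase of round $k$, no non-leader's current command is FLIP$(\mathrm{up},a_k)$. 3. During the phase of round $k$, each non-leader reconfigures exactly one room exactly once, namely $A_k$ from $\mathrm{up}$ to $b_k$,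 and he does so by the FLIP command of round $k$ of his algorithm. 4. Outside the phases only the leader reconfigures rooms. During the transition after round $k$, the rooms $A_0,\dots,A_k$ are in configuration $\mathrm{done}$, and each other room is reconfigured exactly once, from $a_k$ to $b_k$. Finally, whenever a room is in configuration $\mathrm{done}$, every prisoner has already visited it. -/

import Mathlib

namespace Prisoners

/-! ### Rooms, strategies, schedules -/

/-- The configuration of a room with `s` lightswitches: `true` is on, `false` is off. -/
abbrev Config (s : ℕ) : Type := Fin s → Bool

/-- A deterministic strategy of one prisoner. All that the prisoner ever learns is the sequence of
configurations in which he finds the rooms he is led into. In memory state `m`, in a room found in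
configuration `c`, he leaves the room in configuration `leave m c` and passes to memory state
`next m c`. He declares as soon as his memory is in a declaring state. -/
structure Strategy (C M : Type) where
  start : M
  leave : M → C → C
  next : M → C → M
  Declares : M → Prop

/-- The `t`-th visit (counted from `0`) of the schedule `σ` is that of prisoner `(σ t).1` to room
`(σ t).2`. -/
abbrev Schedule (n r : ℕ) : Type := ℕ → Fin n × Fin r

/-- Every prisoner is led into every room arbitrarily many times. -/
def Schedule.Valid {n r : ℕ} (σ : Schedule n r) : Prop :=
  ∀ (p : Fin n) (ρ : Fin r) (N : ℕ), ∃ t, N ≤ t ∧ σ t = (p, ρ)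

/-- The state of the prison at one moment: the configurations of the rooms and the memories of the
prisoners. -/
structure Snapshot (n r s : ℕ) (M : Type) where
  room : Fin r → Config s
  memory : Fin n → M

/-- Prisoner `v.1` visits room `v.2`. -/
def Snapshot.visit {n r s : ℕ} {M : Type} (π : Fin n → Strategy (Config s) M)
    (S : Snapshot n r s M) (v : Fin n × Fin r) : Snapshot n r s M where
  room := Function.update S.room v.2 ((π v.1).leave (S.memory v.1) (S.room v.2))
  memory := Function.update S.memory v.1 ((π v.1).next (S.memory v.1) (S.room v.2))

/-- The prison after the first `t` visits, when all switches of all rooms start off. -/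
def run {n r s : ℕ} {M : Type} (π : Fin n → Strategy (Config s) M) (σ : Schedule n r) :
    ℕ → Snapshot n r s M
  | 0 => ⟨fun _ _ => false, fun p => (π p).start⟩
  | t + 1 => (run π σ t).visit π (σ t)

/-- The protocol `π` wins for `r` rooms with `s` switches that all start off: under every valid
schedule some prisoner declares, and when the first declaration is made, every prisoner has been
in every room. -/
def Winning {n s : ℕ} {M : Type} (π : Fin n → Strategy (Config s) M) (r : ℕ) : Prop :=
  ∀ σ : Schedule n r, σ.Valid → ∃ t : ℕ,
    (∃ p, (π p).Declares ((run π σ t).memory p)) ∧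
    (∀ u < t, ∀ p, ¬ (π p).Declares ((run π σ u).memory p)) ∧
    ∀ (p : Fin n) (ρ : Fin r), ∃ u < t, σ u = (p, ρ)

/-- In the visit number `t`, the visiting prisoner changes the configuration of the room. -/
def Reconfigures {n r s : ℕ} {M : Type} (π : Fin n → Strategy (Config s) M) (σ : Schedule n r)
    (t : ℕ) : Prop :=
  (run π σ (t + 1)).room (σ t).2 ≠ (run π σ t).room (σ t).2

/-! ### The programming language for protocols -/

/-- `flip a b`: wait until you see a room in configuration `a` and then reconfigure it to `b`.
`see a`: wait until you enter a room in configuration `a`. `declare`: announce that every prisoner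
has been in every room. -/
inductive Command (s : ℕ) : Type
  | flip (a b : Config s)
  | see (a : Config s)
  | declare

/-- The parts of the two algorithms, by round `k = 0, 1, 2, …`. For the leader: readying the active
room of round `k`; counting the others and marking the active room as done; the transition after
round `k`; the final declaration. For a non-leader: verifying that round `k` has begun; indicating
his visit to the active room of round `k`. -/
inductive Part : Type
  | ready (k : ℕ)
  | active (k : ℕ)
  | transition (k : ℕ)
  | final
  | verify (k : ℕ)
  | indicate (k : ℕ)

/-- A line of an algorithm: a command, with a comment (which has no effect on the execution)
telling which part of the algorithm it belongs to. -/
structure Line (s : ℕ) : Type where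
  cmd : Command s
  comment : Part

/-- The strategy of executing the lines of a program one after the other (at most one
`flip` or `see` per visit). The memory holds the lines not yet completed. -/
def Strategy.ofProgram {s : ℕ} (prog : List (Line s)) :
    Strategy (Config s) (List (Line s)) where
  start := prog
  leave
    | ⟨.flip a b, _⟩ :: _, c => if c = a then b else c
    | _, c => c
  next
    | ⟨.flip a b, i⟩ :: rest, c => if c = a then rest else ⟨.flip a b, i⟩ :: rest
    | ⟨.see a, i⟩ :: rest, c => if c = a then rest else ⟨.see a, i⟩ :: rest
    | m, _ => m
  Declares m := ∃ i rest, m = ⟨.declare, i⟩ :: rest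

/-! ### The one-room-at-a-time protocol -/

/-- The four configurations of a room with two switches; `c0`, both switches off, is the initial
one. -/
def c0 : Config 2 := ![false, false]
def c1 : Config 2 := ![true, false]
def up : Config 2 := ![false, true]
def done : Config 2 := ![true, true]

/-- Round `k` of the leader's algorithm, where the inactive unfinished rooms are in configuration
`a` and the active room is toggled between `b` and `up`. The number of rooms that the leader has
configured to `done` is `k + 1` in the last loop. -/
def leaderRound (n r : ℕ) (a b : Config 2) (k : ℕ) : List (Line 2) :=
  [⟨.flip a up, .ready k⟩] ++
  List.replicate (n - 2) ⟨.flip b up, .active k⟩ ++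
  [⟨.flip b done, .active k⟩] ++
  List.replicate (r - (k + 1)) ⟨.flip a b, .transition k⟩

/-- Round `k` of a non-leader's algorithm, with `a` and `b` as for the leader. -/
def otherRound (n : ℕ) (a b : Config 2) (k : ℕ) : List (Line 2) :=
  (List.replicate n [⟨.see a, .verify k⟩, ⟨.see up, .verify k⟩]).flatten ++
  [⟨.flip up b, .indicate k⟩]

/-- The leader's algorithm. The double round (a `0`-phase and a `1`-phase, each with the transition
after it) is repeated `(r - 1) / 2` times for odd `r`; for even `r` it is repeated `(r - 2) / 2`
times, and one more `0`-phase with its transition follows. -/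
def leaderProgram (n r : ℕ) : List (Line 2) :=
  (List.range ((r - 1) / 2)).flatMap
    (fun i => leaderRound n r c0 c1 (2 * i) ++ leaderRound n r c1 c0 (2 * i + 1)) ++
  (if Even r then leaderRound n r c0 c1 (r - 2) else []) ++
  [⟨.declare, .final⟩]

/-- The algorithm of the non-leaders. -/
def otherProgram (n r : ℕ) : List (Line 2) :=
  (List.range ((r - 1) / 2)).flatMap
    (fun i => otherRound n c0 c1 (2 * i) ++ otherRound n c1 c0 (2 * i + 1)) ++
  (if Even r then otherRound n c0 c1 (r - 2) else [])

/-- The protocol for `n` prisoners, with leader `ℓ`, and `r` rooms. -/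
def protocol (n r : ℕ) (ℓ : Fin n) : Fin n → Strategy (Config 2) (List (Line 2)) :=
  fun p => Strategy.ofProgram (if p = ℓ then leaderProgram n r else otherProgram n r)

/-- The configuration of the inactive unfinished rooms in round `k`: round `k` is a `0`-phase for
even `k` and a `1`-phase for odd `k`. -/
def idle (k : ℕ) : Config 2 := if Even k then c0 else c1

/-- The configuration between which and `up` the active room is toggled in round `k`. -/
def mark (k : ℕ) : Config 2 := if Even k then c1 else c0

/-- After `t` visits, the next line that prisoner `p` has to complete belongs to part `i`. -/
def AtPart {n r : ℕ} (ℓ : Fin n) (σ : Schedule n r) (t : ℕ) (p : Fin n) (i : Part) : Prop :=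
  ∃ c rest, (run (protocol n r ℓ) σ t).memory p = ⟨c, i⟩ :: rest

/-- After `t` visits, the next command that prisoner `p` has to complete is `c`. -/
def AtCommand {n r : ℕ} (ℓ : Fin n) (σ : Schedule n r) (t : ℕ) (p : Fin n) (c : Command 2) :
    Prop :=
  ∃ i rest, (run (protocol n r ℓ) σ t).memory p = ⟨c, i⟩ :: rest

end Prisoners

namespace Prisoners

/-! ### Configurations -/

/-! In the phase of round `k` the active room alternates between `up` and `mark k`. Each non-leader
turns it from `up` to `mark k` once, and the leader notices this and turns it back, or finally to
`done`. The count of `n - 1` indications is sound if nobody flips the active room out of turn.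

The danger is a prisoner who has already indicated. He is in round `k + 1`, whose verification waits
alternately for `idle (k + 1) = mark k` and `up`, and the active room shows both. He advances only
when that room alternates, so by at most two lines per indication. There are at most `n - 1`
indications, and the verification has `2 * n` lines. At least three are left when the phase ends
(`Counting.step_flipped`, `Counting.three_le`). Outside the phases no room is `up`, so he can
complete at most one `see` line and still has three left (`Ready.step`, `Transit.step`).

Hence the last `see (idle k)` of round `k` is always completed within the phase of round `k`. In the
last round only one room is idle then, so this line forces every non-leader to visit the one room
that is never active (`Counting.step_fresh`). The leader visits it in the transition. Every other
room has been active, hence visited by all.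

For termination, every effective visit consumes a program line, so the prison eventually reaches a
state that no visit changes (`exists_run_fixed`). In each stage of a round some visit changes the
state, so each stage ends. The stages `Ready`, `Counting` and `Transit` are invariants that follow
one another, and `exists_timeline` chains them through all rounds. -/

theorem idle_ne_mark (k : ℕ) : idle k ≠ mark k := by
  unfold idle mark; split_ifs <;> decide

theorem idle_ne_up (k : ℕ) : idle k ≠ up := by
  unfold idle; split_ifs <;> decide

theorem mark_ne_up (k : ℕ) : mark k ≠ up := by
  unfold mark; split_ifs <;> decide

theorem idle_ne_done (k : ℕ) : idle k ≠ done := by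
  unfold idle; split_ifs <;> decide

theorem mark_ne_done (k : ℕ) : mark k ≠ done := by
  unfold mark; split_ifs <;> decide

theorem up_ne_done : up ≠ done := by decide

/-- This equality makes rounds interfere: a prisoner one round ahead waits for the very
configuration that indications produce. It also makes a completed transition the starting position
of the next round. -/
theorem idle_succ (k : ℕ) : idle (k + 1) = mark k := by
  unfold idle mark
  by_cases h : Even k <;> simp [h, Nat.even_add_one]

/-! ### The programs, from a given point on -/

/-- The leader's algorithm from the beginning of round `k`. -/
def leaderFrom (n r k : ℕ) : List (Line 2) :=
  (List.range' k (r - 1 - k)).flatMap (fun j => leaderRound n r (idle j) (mark j) j) ++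
    [⟨.declare, .final⟩]

/-- The leader's algorithm from the point of the transition after round `k` where `m` rooms are
still to be reconfigured. -/
def leaderTransition (n r k m : ℕ) : List (Line 2) :=
  List.replicate m ⟨.flip (idle k) (mark k), .transition k⟩ ++ leaderFrom n r (k + 1)

/-- The leader's algorithm from the point of the phase of round `k` where the active room is to be
reconfigured to `up` another `m` times. -/
def leaderActive (n r k m : ℕ) : List (Line 2) :=
  List.replicate m ⟨.flip (mark k) up, .active k⟩ ++
    ⟨.flip (mark k) done, .active k⟩ :: leaderTransition n r k (r - (k + 1))

/-- The last `w` lines of the verification in round `k` of a non-leader. -/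
def verifyLines (k : ℕ) : ℕ → List (Line 2)
  | 0 => []
  -- Lines are counted from the end, and the last one is `see up`; so parity of the number of
  -- remaining lines determines the awaited configuration.
  | w + 1 => ⟨.see (if Even w then up else idle k), .verify k⟩ :: verifyLines k w

/-- The algorithm of a non-leader from the beginning of round `k`. -/
def otherFrom (n r k : ℕ) : List (Line 2) :=
  (List.range' k (r - 1 - k)).flatMap (fun j => otherRound n (idle j) (mark j) j)

/-- The algorithm of a non-leader from the point of round `k` where `w` lines of the verification
are left; it is empty when there is no round `k`. -/
def otherMem (n r k w : ℕ) : List (Line 2) :=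
  if k + 1 < r then
    verifyLines k w ++ ⟨.flip up (mark k), .indicate k⟩ :: otherFrom n r (k + 1)
  else []

theorem otherRound_eq (n k : ℕ) :
    otherRound n (idle k) (mark k) k =
      verifyLines k (2 * n) ++ [⟨.flip up (mark k), .indicate k⟩] := by
  unfold otherRound
  congr 1
  induction n with
  | zero => rfl
  | succ n ih =>
    rw [List.replicate_succ, List.flatten_cons, ih, show 2 * (n + 1) = 2 * n + 1 + 1 by ring]
    simp [verifyLines]

theorem otherFrom_eq (n r k : ℕ) : otherFrom n r k = otherMem n r k (2 * n) := by
  unfold otherMem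
  split_ifs with h
  · rw [otherFrom, show r - 1 - k = (r - 1 - (k + 1)) + 1 by omega, List.range'_succ]
    simp [otherRound_eq, otherFrom]
  · simp [otherFrom, show r - 1 - k = 0 by omega]

theorem leaderFrom_of_lt {n r k : ℕ} (h : k + 1 < r) :
    leaderFrom n r k = ⟨.flip (idle k) up, .ready k⟩ :: leaderActive n r k (n - 2) := by
  rw [leaderFrom, show r - 1 - k = (r - 1 - (k + 1)) + 1 by omega, List.range'_succ]
  simp [leaderRound, leaderActive, leaderTransition, leaderFrom]

theorem leaderFrom_last {n r k : ℕ} (h : r ≤ k + 1) :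
    leaderFrom n r k = [⟨.declare, .final⟩] := by
  simp [leaderFrom, show r - 1 - k = 0 by omega]

theorem flatMap_range_two_mul {α : Type*} (f : ℕ → List α) (m : ℕ) :
    (List.range m).flatMap (fun i => f (2 * i) ++ f (2 * i + 1)) =
      (List.range (2 * m)).flatMap f := by
  induction m with
  | zero => rfl
  | succ m ih =>
    rw [List.range_succ, List.flatMap_append, ih, show 2 * (m + 1) = 2 * m + 1 + 1 by ring,
      List.range_succ, List.range_succ]
    simp

/-- The `r - 1` rounds pair up, with one even-numbered round left over exactly when `r` is even.
Afterwards both kinds of phase are treated uniformly in `k`. -/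
theorem flatMap_rounds {α : Type*} (f : Config 2 → Config 2 → ℕ → List α) {r : ℕ} (hr : 2 ≤ r) :
    (List.range ((r - 1) / 2)).flatMap (fun i => f c0 c1 (2 * i) ++ f c1 c0 (2 * i + 1)) ++
      (if Even r then f c0 c1 (r - 2) else []) =
    (List.range (r - 1)).flatMap (fun j => f (idle j) (mark j) j) := by
  have h (i : ℕ) : f c0 c1 (2 * i) ++ f c1 c0 (2 * i + 1) =
      f (idle (2 * i)) (mark (2 * i)) (2 * i) ++
        f (idle (2 * i + 1)) (mark (2 * i + 1)) (2 * i + 1) := by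
    simp [idle, mark]
  simp only [h]
  rw [flatMap_range_two_mul (fun j => f (idle j) (mark j) j)]
  rcases Nat.even_or_odd' r with ⟨m, rfl | rfl⟩
  · obtain ⟨m, rfl⟩ : ∃ i, m = i + 1 := ⟨m - 1, by omega⟩
    rw [show 2 * ((2 * (m + 1) - 1) / 2) = 2 * m by omega,
      show 2 * (m + 1) - 1 = 2 * m + 1 by omega, List.range_succ,
      show 2 * (m + 1) - 2 = 2 * m by omega]
    simp [idle, mark]
  · rw [show 2 * ((2 * m + 1 - 1) / 2) = 2 * m by omega]
    simp

theorem leaderProgram_eq {n r : ℕ} (hr : 2 ≤ r) : leaderProgram n r = leaderFrom n r 0 := by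
  rw [leaderProgram, leaderFrom, flatMap_rounds (leaderRound n r) hr, List.range_eq_range']
  rfl

theorem otherProgram_eq {n r : ℕ} (hr : 2 ≤ r) :
    otherProgram n r = otherMem n r 0 (2 * n) := by
  rw [← otherFrom_eq, otherProgram, otherFrom, flatMap_rounds (otherRound n) hr,
    List.range_eq_range']
  rfl

theorem otherMem_of_le {n r k : ℕ} (w : ℕ) (h : r ≤ k + 1) : otherMem n r k w = [] := by
  simp [otherMem, show ¬ k + 1 < r by omega]

theorem otherMem_zero {n r k : ℕ} (h : k + 1 < r) :
    otherMem n r k 0 = ⟨.flip up (mark k), .indicate k⟩ :: otherMem n r (k + 1) (2 * n) := by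
  rw [← otherFrom_eq]
  simp [otherMem, h, verifyLines]

theorem otherMem_succ {n r k : ℕ} (w : ℕ) (h : k + 1 < r) :
    otherMem n r k (w + 1) =
      ⟨.see (if Even w then up else idle k), .verify k⟩ :: otherMem n r k w := by
  simp [otherMem, h, verifyLines]

theorem length_verifyLines (k w : ℕ) : (verifyLines k w).length = w := by
  induction w with
  | zero => rfl
  | succ w ih => simp [verifyLines, ih]

/-- A non-leader in round `k` has strictly more lines left than at the beginning of the next
round. -/
theorem length_otherMem_succ_lt {n r k : ℕ} (w : ℕ) (h : k + 1 < r) :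
    (otherMem n r (k + 1) (2 * n)).length < (otherMem n r k w).length := by
  rw [← otherFrom_eq]
  simp [otherMem, h]
  omega

theorem length_otherMem_le {n r k w : ℕ} (hw : w ≤ 2 * n) :
    (otherMem n r k w).length ≤ (otherMem n r k (2 * n)).length := by
  unfold otherMem
  split_ifs
  · simpa [length_verifyLines] using hw
  · simp

/-! ### Visits -/

section Visit

variable {n r : ℕ} {ℓ p : Fin n} {ρ : Fin r} {S : Snapshot n r 2 (List (Line 2))}
  {a b : Config 2} {i : Part} {rest : List (Line 2)}

theorem visit_flip (h : S.memory p = ⟨.flip a b, i⟩ :: rest) (hρ : S.room ρ = a) :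
    S.visit (protocol n r ℓ) (p, ρ) =
      ⟨Function.update S.room ρ b, Function.update S.memory p rest⟩ := by
  simp [Snapshot.visit, protocol, Strategy.ofProgram, h, hρ]

theorem visit_flip_of_ne (h : S.memory p = ⟨.flip a b, i⟩ :: rest) (hρ : S.room ρ ≠ a) :
    S.visit (protocol n r ℓ) (p, ρ) = S := by
  simp [Snapshot.visit, protocol, Strategy.ofProgram, h, hρ]
  simp [← h]

theorem visit_see (h : S.memory p = ⟨.see a, i⟩ :: rest) (hρ : S.room ρ = a) :
    S.visit (protocol n r ℓ) (p, ρ) = ⟨S.room, Function.update S.memory p rest⟩ := by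
  simp [Snapshot.visit, protocol, Strategy.ofProgram, h, hρ]

theorem visit_see_of_ne (h : S.memory p = ⟨.see a, i⟩ :: rest) (hρ : S.room ρ ≠ a) :
    S.visit (protocol n r ℓ) (p, ρ) = S := by
  simp [Snapshot.visit, protocol, Strategy.ofProgram, h, hρ]
  simp [← h]

theorem visit_declare (h : S.memory p = ⟨.declare, i⟩ :: rest) :
    S.visit (protocol n r ℓ) (p, ρ) = S := by
  simp [Snapshot.visit, protocol, Strategy.ofProgram, h]
  simp [← h]

theorem visit_nil (h : S.memory p = []) : S.visit (protocol n r ℓ) (p, ρ) = S := by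
  simp [Snapshot.visit, protocol, Strategy.ofProgram, h]
  simp [← h]

theorem visit_room_of_ne {v : Fin n × Fin r} (h : ρ ≠ v.2) :
    (S.visit (protocol n r ℓ) v).room ρ = S.room ρ := by
  simp [Snapshot.visit, h]

theorem visit_memory_of_ne {v : Fin n × Fin r} (h : p ≠ v.1) :
    (S.visit (protocol n r ℓ) v).memory p = S.memory p := by
  simp [Snapshot.visit, h]

/-- A visit either changes nothing or uses up a line of an algorithm. -/
theorem visit_eq_or_sum_length_lt (ℓ : Fin n) (S : Snapshot n r 2 (List (Line 2)))
    (v : Fin n × Fin r) :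
    S.visit (protocol n r ℓ) v = S ∨
      ∑ p, ((S.visit (protocol n r ℓ) v).memory p).length < ∑ p, (S.memory p).length := by
  obtain ⟨p, ρ⟩ := v
  have key : ∀ (l : Line 2) (rest : List (Line 2)) (room : Fin r → Config 2),
      S.memory p = l :: rest →
      ∑ q, ((⟨room, Function.update S.memory p rest⟩ :
        Snapshot n r 2 (List (Line 2))).memory q).length < ∑ q, (S.memory q).length := by
    intro l rest room h
    apply Finset.sum_lt_sum
    · intro q _
      by_cases hq : q = p
      · subst hq; simp [h]
      · simp [hq]
    · exact ⟨p, Finset.mem_univ p, by simp [h]⟩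
  rcases h : S.memory p with _ | ⟨⟨⟨a, b⟩ | ⟨a⟩ | _, i⟩, rest⟩
  · exact Or.inl (visit_nil h)
  · by_cases hρ : S.room ρ = a
    · rw [visit_flip h hρ]; exact Or.inr (key _ _ _ h)
    · exact Or.inl (visit_flip_of_ne h hρ)
  · by_cases hρ : S.room ρ = a
    · rw [visit_see h hρ]; exact Or.inr (key _ _ _ h)
    · exact Or.inl (visit_see_of_ne h hρ)
  · exact Or.inl (visit_declare h)

end Visit

/-- Under a valid schedule the prison finally stays in a state that no visit whatsoever changes. -/
theorem exists_run_fixed {n r : ℕ} (ℓ : Fin n) {σ : Schedule n r} (hσ : σ.Valid) :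
    ∃ N, ∀ t, N ≤ t → ∀ v,
      (run (protocol n r ℓ) σ t).visit (protocol n r ℓ) v = run (protocol n r ℓ) σ t := by
  -- This potential drops at every visit that changes anything, so the state is constant once the
  -- minimum is reached. By validity every possible visit is still tried on that state.
  let f : ℕ → ℕ := fun t => ∑ p, ((run (protocol n r ℓ) σ t).memory p).length
  obtain ⟨N, hN⟩ : ∃ N, ∀ t, f N ≤ f t := by
    obtain ⟨N, hN⟩ := WellFounded.has_min Nat.lt_wfRel.wf (Set.range f) ⟨f 0, 0, rfl⟩
    obtain ⟨⟨N, rfl⟩, hN⟩ := And.intro hN.1 hN.2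
    exact ⟨N, fun t => not_lt.1 (hN _ ⟨t, rfl⟩)⟩
  have hc : ∀ t, N ≤ t → run (protocol n r ℓ) σ t = run (protocol n r ℓ) σ N := by
    intro t ht
    induction t, ht using Nat.le_induction with
    | base => rfl
    | succ t ht ih =>
      rcases visit_eq_or_sum_length_lt ℓ (run (protocol n r ℓ) σ t) (σ t) with h | h
      · exact (show run (protocol n r ℓ) σ (t + 1) = _ from h).trans ih
      · rw [ih] at h
        have := hN (t + 1)
        simp only [f, run, ih] at this
        omega
  refine ⟨N, fun t ht v => ?_⟩
  obtain ⟨u, hu, huv⟩ := hσ v.1 v.2 N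
  rw [hc t ht]
  have := hc (u + 1) (by omega)
  rwa [run, hc u hu, huv] at this

/-! ### The stages of a round -/

section Stages

variable {n r : ℕ}

/-- The leader waits for the active room of round `k`, and `D` is the set of rooms that are done;
`V p ρ` says that prisoner `p` has been in room `ρ`. When there is no round `k`, the protocol is
over. -/
structure Ready (ℓ : Fin n) (k : ℕ) (D : Finset (Fin r)) (S : Snapshot n r 2 (List (Line 2)))
    (V : Fin n → Fin r → Prop) : Prop where
  card_done : D.card = k
  leader : S.memory ℓ = leaderFrom n r k
  room_done : ∀ ρ ∈ D, S.room ρ = done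
  room_idle : ∀ ρ ∉ D, S.room ρ = idle k
  -- The bound `3` keeps the final pair `see (idle k)`, `see up` in reserve for the phase.
  other : ∀ p, p ≠ ℓ → ∃ w, 3 ≤ w ∧ w ≤ 2 * n ∧ S.memory p = otherMem n r k w
  seen_done : ∀ ρ ∈ D, ∀ p, V p ρ
  seen_all : k + 1 = r → ∀ p ρ, V p ρ

/-- The phase of round `k` with active room `A`. The leader will reconfigure `A` to `up` another `m`
times, `F` is the set of non-leaders who have indicated their visit, and `e` is the number of
indications not yet noticed by the leader. -/
structure Counting (ℓ : Fin n) (k : ℕ) (D : Finset (Fin r)) (A : Fin r) (m : ℕ)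
    (F : Finset (Fin n)) (e : ℕ) (S : Snapshot n r 2 (List (Line 2)))
    (V : Fin n → Fin r → Prop) : Prop where
  card_done : D.card = k
  lt : k + 1 < r
  active_notMem : A ∉ D
  leader_notMem : ℓ ∉ F
  leader : S.memory ℓ = leaderActive n r k m
  room_done : ∀ ρ ∈ D, S.room ρ = done
  room_idle : ∀ ρ ∉ D, ρ ≠ A → S.room ρ = idle k
  room_active : S.room A = up ∧ e = 0 ∨ S.room A = mark k ∧ e = 1
  -- The leader's `m + 1` remaining reconfigurations in this phase answer the `n - 1 - F.card`
  -- indications to come and the `e` unnoticed ones.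
  count : F.card + m + 2 = n + e
  fresh : ∀ p, p ≠ ℓ → p ∉ F → ∃ w, w ≤ 2 * n ∧ S.memory p = otherMem n r k w ∧
    (w ≤ 1 → k + 2 = r → ∀ ρ ∉ D, ρ ≠ A → V p ρ)
  -- At most two lines of round `k + 1` are used up per indication; the summand `e` accounts for the
  -- `see up` that must await the leader.
  flipped : ∀ p ∈ F, ∃ w, 2 * n + e ≤ w + 2 * F.card ∧ w ≤ 2 * n ∧
    S.memory p = otherMem n r (k + 1) w
  seen_done : ∀ ρ ∈ D, ∀ p, V p ρ
  seen_active : ∀ p, p = ℓ ∨ p ∈ F → V p A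
  seen_idle : ∀ p ∈ F, k + 2 = r → ∀ ρ ∉ D, ρ ≠ A → V p ρ

/-- The transition after round `k`, where `I` is the set of rooms still to be reconfigured. -/
structure Transit (ℓ : Fin n) (k : ℕ) (D I : Finset (Fin r)) (S : Snapshot n r 2 (List (Line 2)))
    (V : Fin n → Fin r → Prop) : Prop where
  card_done : D.card = k + 1
  lt : k + 1 < r
  disjoint : Disjoint D I
  leader : S.memory ℓ = leaderTransition n r k I.card
  room_done : ∀ ρ ∈ D, S.room ρ = done
  room_idle : ∀ ρ ∈ I, S.room ρ = idle k
  room_mark : ∀ ρ ∉ D, ρ ∉ I → S.room ρ = mark k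
  other : ∀ p, p ≠ ℓ → ∃ w, 3 ≤ w ∧ w ≤ 2 * n ∧ S.memory p = otherMem n r (k + 1) w
  seen_done : ∀ ρ ∈ D, ∀ p, V p ρ
  seen_leader : ∀ ρ ∉ I, V ℓ ρ
  seen_other : k + 2 = r → ∀ p, p ≠ ℓ → ∀ ρ, V p ρ

variable {ℓ p : Fin n} {k m e w : ℕ} {D I : Finset (Fin r)} {A ρ : Fin r} {F : Finset (Fin n)}
  {S : Snapshot n r 2 (List (Line 2))} {V V' : Fin n → Fin r → Prop} {v : Fin n × Fin r}

theorem Ready.mono (h : Ready ℓ k D S V) (hV : ∀ p ρ, V p ρ → V' p ρ) : Ready ℓ k D S V' :=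
  { h with
    seen_done := fun ρ hρ p => hV _ _ (h.seen_done ρ hρ p)
    seen_all := fun hk p ρ => hV _ _ (h.seen_all hk p ρ) }

theorem Counting.mono (h : Counting ℓ k D A m F e S V) (hV : ∀ p ρ, V p ρ → V' p ρ) :
    Counting ℓ k D A m F e S V' :=
  { h with
    fresh := fun p hp hF => by
      obtain ⟨w, h1, h2, h3⟩ := h.fresh p hp hF
      exact ⟨w, h1, h2, fun a b ρ c d => hV _ _ (h3 a b ρ c d)⟩
    seen_done := fun ρ hρ p => hV _ _ (h.seen_done ρ hρ p)
    seen_active := fun p hp => hV _ _ (h.seen_active p hp)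
    seen_idle := fun p a b ρ c d => hV _ _ (h.seen_idle p a b ρ c d) }

theorem Transit.mono (h : Transit ℓ k D I S V) (hV : ∀ p ρ, V p ρ → V' p ρ) :
    Transit ℓ k D I S V' :=
  { h with
    seen_done := fun ρ hρ p => hV _ _ (h.seen_done ρ hρ p)
    seen_leader := fun ρ hρ => hV _ _ (h.seen_leader ρ hρ)
    seen_other := fun a p b ρ => hV _ _ (h.seen_other a p b ρ) }

/-- What the visit of a non-leader can do. -/
theorem visit_other_cases (ℓ : Fin n) (h : S.memory p = otherMem n r k w) (ρ : Fin r) :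
    S.visit (protocol n r ℓ) (p, ρ) = S ∨
    (k + 1 < r ∧ w = 0 ∧ S.room ρ = up ∧ S.visit (protocol n r ℓ) (p, ρ) =
      ⟨Function.update S.room ρ (mark k),
        Function.update S.memory p (otherMem n r (k + 1) (2 * n))⟩) ∨
    (k + 1 < r ∧ ∃ w', w = w' + 1 ∧ S.room ρ = (if Even w' then up else idle k) ∧
      S.visit (protocol n r ℓ) (p, ρ) =
        ⟨S.room, Function.update S.memory p (otherMem n r k w')⟩) := by
  by_cases hk : k + 1 < r
  · rcases w with _ | w
    · rw [otherMem_zero hk] at h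
      by_cases hρ : S.room ρ = up
      · exact Or.inr (Or.inl ⟨hk, rfl, hρ, visit_flip h hρ⟩)
      · exact Or.inl (visit_flip_of_ne h hρ)
    · rw [otherMem_succ w hk] at h
      by_cases hρ : S.room ρ = (if Even w then up else idle k)
      · exact Or.inr (Or.inr ⟨hk, w, rfl, hρ, visit_see h hρ⟩)
      · exact Or.inl (visit_see_of_ne h hρ)
  · rw [otherMem_of_le _ (by omega)] at h
    exact Or.inl (visit_nil h)

/-- A non-leader reconfigures a room only by an `indicate` line. -/
theorem room_visit_other (ℓ : Fin n) (h : S.memory p = otherMem n r k w)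
    (hne : (S.visit (protocol n r ℓ) (p, ρ)).room ρ ≠ S.room ρ) :
    k + 1 < r ∧ w = 0 ∧ S.room ρ = up ∧ S.visit (protocol n r ℓ) (p, ρ) =
      ⟨Function.update S.room ρ (mark k),
        Function.update S.memory p (otherMem n r (k + 1) (2 * n))⟩ := by
  rcases visit_other_cases ℓ h ρ with h1 | h1 | ⟨-, w', -, -, h1⟩
  · simp [h1] at hne
  · exact h1
  · simp [h1] at hne

/-! ### Rooms in the stages -/

theorem Ready.room_ne_up (h : Ready ℓ k D S V) (ρ : Fin r) : S.room ρ ≠ up := by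
  by_cases hρ : ρ ∈ D
  · rw [h.room_done ρ hρ]; exact up_ne_done.symm
  · rw [h.room_idle ρ hρ]; exact idle_ne_up k

theorem Transit.room_ne_up (h : Transit ℓ k D I S V) (ρ : Fin r) : S.room ρ ≠ up := by
  by_cases hρ : ρ ∈ D
  · rw [h.room_done ρ hρ]; exact up_ne_done.symm
  by_cases hI : ρ ∈ I
  · rw [h.room_idle ρ hI]; exact idle_ne_up k
  · rw [h.room_mark ρ hρ hI]; exact mark_ne_up k

theorem Ready.mem_of_done (h : Ready ℓ k D S V) (hρ : S.room ρ = done) : ρ ∈ D := by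
  by_contra hD
  rw [h.room_idle ρ hD] at hρ
  exact idle_ne_done k hρ

theorem Counting.mem_of_done (h : Counting ℓ k D A m F e S V) (hρ : S.room ρ = done) : ρ ∈ D := by
  by_contra hD
  by_cases hA : ρ = A
  · subst hA
    rcases h.room_active with h | h <;> rw [h.1] at hρ
    · exact up_ne_done hρ
    · exact mark_ne_done k hρ
  · rw [h.room_idle ρ hD hA] at hρ
    exact idle_ne_done k hρ

theorem Transit.mem_of_done (h : Transit ℓ k D I S V) (hρ : S.room ρ = done) : ρ ∈ D := by
  by_contra hD
  by_cases hI : ρ ∈ I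
  · rw [h.room_idle ρ hI] at hρ; exact idle_ne_done k hρ
  · rw [h.room_mark ρ hD hI] at hρ; exact mark_ne_done k hρ

theorem Counting.eq_of_up (h : Counting ℓ k D A m F e S V) (hρ : S.room ρ = up) :
    ρ = A ∧ e = 0 := by
  have hA : ρ = A := by
    by_contra hA
    by_cases hD : ρ ∈ D
    · rw [h.room_done ρ hD] at hρ; exact up_ne_done hρ.symm
    · rw [h.room_idle ρ hD hA] at hρ; exact idle_ne_up k hρ
  subst hA
  refine ⟨rfl, ?_⟩
  rcases h.room_active with h | h
  · exact h.2
  · exact absurd (h.1.symm.trans hρ) (mark_ne_up k)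

theorem Counting.eq_of_mark (h : Counting ℓ k D A m F e S V) (hρ : S.room ρ = mark k) :
    ρ = A ∧ e = 1 := by
  have hA : ρ = A := by
    by_contra hA
    by_cases hD : ρ ∈ D
    · rw [h.room_done ρ hD] at hρ; exact mark_ne_done k hρ.symm
    · rw [h.room_idle ρ hD hA] at hρ; exact idle_ne_mark k hρ
  subst hA
  refine ⟨rfl, ?_⟩
  rcases h.room_active with h | h
  · exact absurd (hρ.symm.trans h.1) (mark_ne_up k)
  · exact h.2

theorem Counting.idle_of_idle (h : Counting ℓ k D A m F e S V) (hρ : S.room ρ = idle k) :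
    ρ ∉ D ∧ ρ ≠ A := by
  constructor
  · intro hD
    exact idle_ne_done k (hρ.symm.trans (h.room_done ρ hD))
  · rintro rfl
    rcases h.room_active with h | h
    · exact idle_ne_up k (hρ.symm.trans h.1)
    · exact idle_ne_mark k (hρ.symm.trans h.1)

theorem Transit.mem_of_idle (h : Transit ℓ k D I S V) (hρ : S.room ρ = idle k) : ρ ∈ I := by
  by_contra hI
  by_cases hD : ρ ∈ D
  · exact idle_ne_done k (hρ.symm.trans (h.room_done ρ hD))
  · exact idle_ne_mark k (hρ.symm.trans (h.room_mark ρ hD hI))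

/-- By `count`, `F.card ≤ n - 2` when `e = 0`, while `F.card ≤ n - 1` always, as the leader is not
in `F`. This leaves four and three lines respectively. -/
theorem Counting.three_le (h : Counting ℓ k D A m F e S V) (hw : 2 * n + e ≤ w + 2 * F.card) :
    3 ≤ w := by
  have := h.count
  have hF : F.card < n := by
    simpa using Finset.card_lt_univ_of_notMem h.leader_notMem
  rcases h.room_active with ⟨-, he⟩ | ⟨-, he⟩ <;> omega

/-- At most one room is neither done nor active in the last round. -/
theorem Counting.eq_of_idle (h : Counting ℓ k D A m F e S V) (hk : k + 2 = r) {ρ ρ' : Fin r}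
    (hρ : ρ ∉ D ∧ ρ ≠ A) (hρ' : ρ' ∉ D ∧ ρ' ≠ A) : ρ = ρ' := by
  by_contra hne
  have h1 : (insert ρ (insert ρ' (insert A D))).card = k + 3 := by
    rw [Finset.card_insert_of_notMem, Finset.card_insert_of_notMem, Finset.card_insert_of_notMem,
      h.card_done]
    · exact h.active_notMem
    · simp [hρ']
    · simp [hρ, hne]
  have h2 := Finset.card_le_univ (insert ρ (insert ρ' (insert A D)))
  simp at h2
  omega

/-! ### Steps -/

/-- As no room is `up`, non-leaders can only complete `see (idle k)`; the stage ends by the leader's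
flip alone. -/
theorem Ready.step (hn : 2 ≤ n) (h : Ready ℓ k D S V) (hk : k + 1 < r)
    (hV : ∀ p ρ, V p ρ → V' p ρ) (hv : V' v.1 v.2) :
    Ready ℓ k D (S.visit (protocol n r ℓ) v) V' ∨
      ∃ A, Counting ℓ k D A (n - 2) ∅ 0 (S.visit (protocol n r ℓ) v) V' := by
  obtain ⟨p, ρ⟩ := v
  by_cases hp : p = ℓ
  · subst hp
    have hl := h.leader
    rw [leaderFrom_of_lt hk] at hl
    by_cases hρ : S.room ρ = idle k
    · right
      have hD : ρ ∉ D := fun hD => idle_ne_done k (hρ.symm.trans (h.room_done ρ hD))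
      rw [visit_flip hl hρ]
      refine ⟨ρ, h.card_done, hk, hD, by simp, by simp, ?_, ?_, by simp, by simp; omega, ?_,
        by simp, fun ρ hρ p => hV _ _ (h.seen_done ρ hρ p), ?_, by simp⟩
      · intro ρ' h'
        have : ρ' ≠ ρ := by rintro rfl; exact hD h'
        simp [this, h.room_done ρ' h']
      · intro ρ' h' hne
        simp [hne, h.room_idle ρ' h']
      · intro q hq _
        obtain ⟨w, h3, hw, hm⟩ := h.other q hq
        exact ⟨w, hw, by simp [hq, hm], by omega⟩
      · rintro q (rfl | hq)
        · exact hv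
        · simp at hq
    · rw [visit_flip_of_ne hl hρ]
      exact Or.inl (h.mono hV)
  · left
    obtain ⟨w, h3, hw, hm⟩ := h.other p hp
    rcases visit_other_cases ℓ hm ρ with h1 | ⟨-, -, h1, -⟩ | ⟨-, w', rfl, h1, h2⟩
    · rw [h1]; exact h.mono hV
    · exact absurd h1 (h.room_ne_up ρ)
    · have hw' : ¬ Even w' := fun he => h.room_ne_up ρ (by simpa [he] using h1)
      rw [h2]
      refine { h.mono hV with leader := ?_, other := ?_ }
      · simp [Ne.symm hp, h.leader]
      · intro q hq
        by_cases hqp : q = p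
        · subst hqp
          refine ⟨w', ?_, by omega, by simp⟩
          rcases Nat.not_even_iff_odd.1 hw' with ⟨j, rfl⟩
          omega
        · simpa [hqp] using h.other q hq

theorem Transit.step (h : Transit ℓ k D I S V) (hI : I.Nonempty)
    (hV : ∀ p ρ, V p ρ → V' p ρ) (hv : V' v.1 v.2) :
    ∃ I', Transit ℓ k D I' (S.visit (protocol n r ℓ) v) V' := by
  obtain ⟨p, ρ⟩ := v
  by_cases hp : p = ℓ
  · subst hp
    have hl := h.leader
    obtain ⟨c, hc⟩ : ∃ c, I.card = c + 1 := ⟨I.card - 1, by have := hI.card_pos; omega⟩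
    rw [leaderTransition, hc, List.replicate_succ, List.cons_append, ← leaderTransition] at hl
    by_cases hρ : S.room ρ = idle k
    · have hI := h.mem_of_idle hρ
      have hD : ρ ∉ D := fun hD => Finset.disjoint_left.1 h.disjoint hD hI
      rw [visit_flip hl hρ]
      refine ⟨I.erase ρ, { h.mono hV with
        disjoint := ?_, leader := ?_, room_done := ?_, room_idle := ?_, room_mark := ?_,
        other := ?_, seen_leader := ?_ }⟩
      · exact h.disjoint.mono_right (Finset.erase_subset _ _)
      · simp [Finset.card_erase_of_mem hI, hc]
      · intro ρ' h'
        have : ρ' ≠ ρ := by rintro rfl; exact hD h'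
        simp [this, h.room_done ρ' h']
      · intro ρ' h'
        have := Finset.ne_of_mem_erase h'
        simp [this, h.room_idle ρ' (Finset.mem_of_mem_erase h')]
      · intro ρ' h1 h2
        by_cases hne : ρ' = ρ
        · simp [hne]
        · have : ρ' ∉ I := fun hh => h2 (Finset.mem_erase.2 ⟨hne, hh⟩)
          simp [hne, h.room_mark ρ' h1 this]
      · intro q hq
        simpa [hq] using h.other q hq
      · intro ρ' h'
        by_cases hne : ρ' = ρ
        · subst hne; exact hv
        · exact hV _ _ (h.seen_leader ρ' fun hh => h' (Finset.mem_erase.2 ⟨hne, hh⟩))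
    · rw [visit_flip_of_ne hl hρ]
      exact ⟨I, h.mono hV⟩
  · refine ⟨I, ?_⟩
    obtain ⟨w, h3, hw, hm⟩ := h.other p hp
    rcases visit_other_cases ℓ hm ρ with h1 | ⟨-, -, h1, -⟩ | ⟨-, w', rfl, h1, h2⟩
    · rw [h1]; exact h.mono hV
    · exact absurd h1 (h.room_ne_up ρ)
    · have hw' : ¬ Even w' := fun he => h.room_ne_up ρ (by simpa [he] using h1)
      rw [h2]
      refine { h.mono hV with leader := ?_, other := ?_ }
      · simp [Ne.symm hp, h.leader]
      · intro q hq
        by_cases hqp : q = p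
        · subst hqp
          refine ⟨w', ?_, by omega, by simp⟩
          rcases Nat.not_even_iff_odd.1 hw' with ⟨j, rfl⟩
          omega
        · simpa [hqp] using h.other q hq

/-- When the transition is over, the leader is ready for the next round. -/
theorem Transit.ready (h : Transit ℓ k D ∅ S V) : Ready ℓ (k + 1) D S V where
  card_done := h.card_done
  leader := by simpa [leaderTransition] using h.leader
  room_done := h.room_done
  room_idle ρ hρ := by rw [idle_succ]; exact h.room_mark ρ hρ (by simp)
  other := h.other
  seen_done := h.seen_done
  seen_all hk p ρ := by
    by_cases hp : p = ℓ
    · subst hp; exact h.seen_leader ρ (by simp)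
    · exact h.seen_other hk p hp ρ

theorem Counting.step_leader (h : Counting ℓ k D A m F e S V)
    (hV : ∀ p ρ, V p ρ → V' p ρ) (hv : V' ℓ ρ) :
    (∃ m' F' e', Counting ℓ k D A m' F' e' (S.visit (protocol n r ℓ) (ℓ, ρ)) V') ∨
      Transit ℓ k (insert A D) (insert A D)ᶜ (S.visit (protocol n r ℓ) (ℓ, ρ)) V' := by
  have hl := h.leader
  have hc := h.count
  by_cases hρ : S.room ρ = mark k
  · obtain ⟨rfl, rfl⟩ := h.eq_of_mark hρ
    rcases m with _ | m
    · right
      simp only [leaderActive, List.replicate_zero, List.nil_append] at hl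
      rw [visit_flip hl hρ]
      -- Here `m = 0` and `e = 1`, so `count` gives `F.card = n - 1`.
      have hF : ∀ p, p ≠ ℓ → p ∈ F := by
        have : insert ℓ F = Finset.univ := by
          apply Finset.eq_univ_of_card
          rw [Finset.card_insert_of_notMem h.leader_notMem, Fintype.card_fin]
          omega
        intro p hp
        have h' := Finset.mem_univ p
        rw [← this] at h'
        exact Finset.mem_of_mem_insert_of_ne h' hp
      have hcard : (insert ρ D).card = k + 1 := by
        rw [Finset.card_insert_of_notMem h.active_notMem, h.card_done]
      have hseen : ∀ ρ' ∈ insert ρ D, ∀ p, V' p ρ' := by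
        intro ρ' h' p
        rcases Finset.mem_insert.1 h' with rfl | h'
        · by_cases hp : p = ℓ
          · exact hp ▸ hv
          · exact hV _ _ (h.seen_active p (Or.inr (hF p hp)))
        · exact hV _ _ (h.seen_done ρ' h' p)
      refine ⟨hcard, h.lt, disjoint_compl_right, ?_, ?_, ?_, ?_, ?_, hseen, ?_, ?_⟩
      · rw [Finset.card_compl, hcard]
        simp
      · intro ρ' h'
        by_cases hne : ρ' = ρ
        · simp [hne]
        · simp [hne, h.room_done ρ' (Finset.mem_of_mem_insert_of_ne h' hne)]
      · intro ρ' h'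
        simp only [Finset.mem_compl, Finset.mem_insert, not_or] at h'
        simp [h'.1, h.room_idle ρ' h'.2 h'.1]
      · intro ρ' h1 h2
        exact absurd (Finset.mem_compl.2 h1) h2
      · intro q hq
        obtain ⟨w, h1, h2, h3⟩ := h.flipped q (hF q hq)
        exact ⟨w, h.three_le h1, h2, by simp [hq, h3]⟩
      · intro ρ' h'
        exact hseen ρ' (by rwa [Finset.mem_compl, not_not] at h') ℓ
      · intro hk p hp ρ'
        by_cases h' : ρ' ∈ insert ρ D
        · exact hseen ρ' h' p
        · simp only [Finset.mem_insert, not_or] at h'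
          exact hV _ _ (h.seen_idle p (hF p hp) hk ρ' h'.2 h'.1)
    · left
      rw [leaderActive, List.replicate_succ, List.cons_append, ← leaderActive] at hl
      rw [visit_flip hl hρ]
      refine ⟨m, F, 0, { h.mono hV with
        leader := ?_, room_done := ?_, room_idle := ?_, room_active := ?_,
        count := ?_, fresh := ?_, flipped := ?_ }⟩
      · simp
      · intro ρ' h'
        have : ρ' ≠ ρ := by rintro rfl; exact h.active_notMem h'
        simp [this, h.room_done ρ' h']
      · intro ρ' h' hne
        simp [hne, h.room_idle ρ' h' hne]
      · simp
      · omega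
      · intro q hq hF
        simpa [hq] using (h.mono hV).fresh q hq hF
      · intro q hF
        have hq : q ≠ ℓ := by rintro rfl; exact h.leader_notMem hF
        obtain ⟨w, h1, h2, h3⟩ := h.flipped q hF
        exact ⟨w, by omega, h2, by simp [hq, h3]⟩
  · left
    refine ⟨m, F, e, ?_⟩
    have : S.visit (protocol n r ℓ) (ℓ, ρ) = S := by
      rcases m with _ | m
      · simp only [leaderActive, List.replicate_zero, List.nil_append] at hl
        exact visit_flip_of_ne hl hρ
      · rw [leaderActive, List.replicate_succ, List.cons_append] at hl
        exact visit_flip_of_ne hl hρ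
    rw [this]
    exact h.mono hV

/-- Parity preserves the bound in `flipped`. A `see up` is completed with `e = 0` and an odd number
of lines left, a `see (mark k)` with `e = 1` and an even number. Either way the two sides differ in
parity, so the inequality was strict and one line can be spared. -/
theorem Counting.step_flipped (h : Counting ℓ k D A m F e S V) (hp : p ∈ F)
    (hV : ∀ p ρ, V p ρ → V' p ρ) :
    Counting ℓ k D A m F e (S.visit (protocol n r ℓ) (p, ρ)) V' := by
  have hpl : p ≠ ℓ := by rintro rfl; exact h.leader_notMem hp
  obtain ⟨w, h1, h2, h3⟩ := h.flipped p hp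
  have hw := h.three_le h1
  rcases visit_other_cases ℓ h3 ρ with hc | ⟨-, h0, -⟩ | ⟨-, w', rfl, hroom, hc⟩
  · rw [hc]; exact h.mono hV
  · omega
  · rw [hc]
    refine { h.mono hV with leader := ?_, fresh := ?_, flipped := ?_ }
    · simp [hpl.symm, h.leader]
    · intro q hq hF
      have : q ≠ p := by rintro rfl; exact hF hp
      simpa [this] using (h.mono hV).fresh q hq hF
    · intro q hF
      by_cases hqp : q = p
      · subst hqp
        refine ⟨w', ?_, by omega, by simp⟩
        by_cases hw' : Even w'
        · obtain ⟨-, rfl⟩ := h.eq_of_up (ρ := ρ) (by simpa [hw'] using hroom)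
          obtain ⟨j, rfl⟩ := hw'
          omega
        · obtain ⟨-, rfl⟩ := h.eq_of_mark (ρ := ρ) (by simpa [hw', idle_succ] using hroom)
          obtain ⟨j, rfl⟩ := Nat.not_even_iff_odd.1 hw'
          omega
      · simpa [hqp] using h.flipped q hF

theorem Counting.step_fresh (h : Counting ℓ k D A m F e S V) (hpl : p ≠ ℓ) (hp : p ∉ F)
    (hV : ∀ p ρ, V p ρ → V' p ρ) (hv : V' p ρ) :
    ∃ F' e', Counting ℓ k D A m F' e' (S.visit (protocol n r ℓ) (p, ρ)) V' := by
  obtain ⟨w, h1, h2, h3⟩ := h.fresh p hpl hp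
  rcases visit_other_cases ℓ h2 ρ with hc | ⟨-, rfl, hup, hc⟩ | ⟨-, w', rfl, hroom, hc⟩
  · rw [hc]; exact ⟨F, e, h.mono hV⟩
  · obtain ⟨rfl, rfl⟩ := h.eq_of_up hup
    have hcount := h.count
    have hcard := Finset.card_insert_of_notMem hp
    rw [hc]
    refine ⟨insert p F, 1, { h.mono hV with
      leader_notMem := ?_, leader := ?_, room_done := ?_, room_idle := ?_,
      room_active := ?_, count := ?_, fresh := ?_, flipped := ?_, seen_active := ?_, seen_idle := ?_ }⟩
    · simp [h.leader_notMem, hpl.symm]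
    · simp [hpl.symm, h.leader]
    · intro ρ' h'
      have : ρ' ≠ ρ := by rintro rfl; exact h.active_notMem h'
      simp [this, h.room_done ρ' h']
    · intro ρ' h' hne
      simp [hne, h.room_idle ρ' h' hne]
    · simp
    · omega
    · intro q hq hF
      simp only [Finset.mem_insert, not_or] at hF
      simpa [hF.1] using (h.mono hV).fresh q hq hF.2
    · intro q hF
      by_cases hqp : q = p
      · subst hqp
        exact ⟨2 * n, by omega, le_rfl, by simp⟩
      -- The bound gains `2` from the new element of `F` and loses `1` to the new value of `e`.
      · obtain ⟨w, h1, h2, h3⟩ := h.flipped q (Finset.mem_of_mem_insert_of_ne hF hqp)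
        exact ⟨w, by omega, h2, by simp [hqp, h3]⟩
    · intro q hq
      by_cases hqp : q = p
      · exact hqp ▸ hv
      · exact hV _ _ (h.seen_active q (by simpa [hqp] using hq))
    · intro q hq hk ρ' h' hne
      by_cases hqp : q = p
      · exact hqp ▸ hV _ _ (h3 (by omega) hk ρ' h' hne)
      · exact hV _ _ (h.seen_idle q (Finset.mem_of_mem_insert_of_ne hq hqp) hk ρ' h' hne)
  · rw [hc]
    refine ⟨F, e, { h.mono hV with leader := ?_, fresh := ?_, flipped := ?_ }⟩
    · simp [hpl.symm, h.leader]
    · intro q hq hF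
      by_cases hqp : q = p
      · subst hqp
        refine ⟨w', by omega, by simp, ?_⟩
        intro hw1 hk ρ' h' hne
        by_cases hw' : Even w'
        · exact hV _ _ (h3 (by obtain ⟨j, rfl⟩ := hw'; omega) hk ρ' h' hne)
        -- This is the last `see (idle k)` of the last round: the room seen is the only idle one.
        · have := h.idle_of_idle (ρ := ρ) (by simpa [hw'] using hroom)
          rw [h.eq_of_idle hk ⟨h', hne⟩ this]
          exact hv
      · simpa [hqp] using (h.mono hV).fresh q hq hF
    · intro q hF
      have : q ≠ p := by rintro rfl; exact hp hF
      simpa [this] using h.flipped q hF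

theorem Counting.step (h : Counting ℓ k D A m F e S V)
    (hV : ∀ p ρ, V p ρ → V' p ρ) (hv : V' v.1 v.2) :
    (∃ m' F' e', Counting ℓ k D A m' F' e' (S.visit (protocol n r ℓ) v) V') ∨
      Transit ℓ k (insert A D) (insert A D)ᶜ (S.visit (protocol n r ℓ) v) V' := by
  obtain ⟨p, ρ⟩ := v
  by_cases hpl : p = ℓ
  · subst hpl
    exact h.step_leader hV hv
  by_cases hp : p ∈ F
  · exact Or.inl ⟨m, F, e, h.step_flipped hp hV⟩
  · exact Or.inl ⟨m, h.step_fresh hpl hp hV hv⟩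

/-! ### No stage lasts forever -/

theorem exists_notMem_of_card_lt {s : Finset (Fin r)} (h : s.card < r) : ∃ ρ, ρ ∉ s := by
  by_contra! hs
  rw [Finset.eq_univ_of_forall hs, Finset.card_univ, Fintype.card_fin] at h
  omega

theorem Ready.exists_visit_ne (h : Ready ℓ k D S V) (hk : k + 1 < r) :
    ∃ v, S.visit (protocol n r ℓ) v ≠ S := by
  obtain ⟨ρ, hρ⟩ := exists_notMem_of_card_lt (s := D) (by rw [h.card_done]; omega)
  have hl := h.leader
  rw [leaderFrom_of_lt hk] at hl
  refine ⟨(ℓ, ρ), fun hS => ?_⟩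
  rw [visit_flip hl (h.room_idle ρ hρ)] at hS
  have := congrArg (fun S => S.memory ℓ) hS
  simp [hl] at this

theorem Transit.exists_visit_ne (h : Transit ℓ k D I S V) (hI : I.Nonempty) :
    ∃ v, S.visit (protocol n r ℓ) v ≠ S := by
  have hl := h.leader
  obtain ⟨c, hc⟩ : ∃ c, I.card = c + 1 := ⟨I.card - 1, by have := hI.card_pos; omega⟩
  rw [leaderTransition, hc, List.replicate_succ, List.cons_append] at hl
  obtain ⟨ρ, hρ⟩ := hI
  refine ⟨(ℓ, ρ), fun hS => ?_⟩
  rw [visit_flip hl (h.room_idle ρ hρ)] at hS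
  have := congrArg (fun S => S.memory ℓ) hS
  simp [hl] at this

/-- If the active room is `up`, then `count` provides a non-leader outside `F`, and both
configurations he can wait for occur, since `k + 1 < r` leaves an idle room. If it is `mark k`, the
leader can act. -/
theorem Counting.exists_visit_ne (h : Counting ℓ k D A m F e S V) :
    ∃ v, S.visit (protocol n r ℓ) v ≠ S := by
  rcases h.room_active with ⟨hA, rfl⟩ | ⟨hA, rfl⟩
  · obtain ⟨p, hp⟩ := exists_notMem_of_card_lt (s := insert ℓ F) (by
      have := h.count
      rw [Finset.card_insert_of_notMem h.leader_notMem]; omega)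
    simp only [Finset.mem_insert, not_or] at hp
    obtain ⟨w, -, hm, -⟩ := h.fresh p hp.1 hp.2
    rcases w with _ | w
    · rw [otherMem_zero h.lt] at hm
      refine ⟨(p, A), fun hS => ?_⟩
      rw [visit_flip hm hA] at hS
      have := congrArg (fun S => S.memory p) hS
      simp [hm] at this
    · rw [otherMem_succ w h.lt] at hm
      obtain ⟨ρ, hρ⟩ : ∃ ρ, S.room ρ = (if Even w then up else idle k) := by
        split_ifs
        · exact ⟨A, hA⟩
        · obtain ⟨ρ, hρ⟩ := exists_notMem_of_card_lt (s := insert A D) (by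
            rw [Finset.card_insert_of_notMem h.active_notMem, h.card_done]; exact h.lt)
          simp only [Finset.mem_insert, not_or] at hρ
          exact ⟨ρ, h.room_idle ρ hρ.2 hρ.1⟩
      refine ⟨(p, ρ), fun hS => ?_⟩
      rw [visit_see hm hρ] at hS
      have := congrArg (fun S => S.memory p) hS
      simp [hm] at this
  · obtain ⟨l, i, rest, hl⟩ : ∃ b i rest, S.memory ℓ = ⟨.flip (mark k) b, i⟩ :: rest := by
      rw [h.leader]
      rcases m with _ | m
      · exact ⟨done, _, _, rfl⟩
      · exact ⟨up, _, _, rfl⟩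
    refine ⟨(ℓ, A), fun hS => ?_⟩
    rw [visit_flip hl hA] at hS
    have := congrArg (fun S => S.memory ℓ) hS
    simp [hl] at this

end Stages

/-! ### Who reconfigures which room -/

section Reconfiguration

variable {n r : ℕ} {ℓ p : Fin n} {k m e : ℕ} {D I : Finset (Fin r)} {A ρ : Fin r}
  {F : Finset (Fin n)} {S : Snapshot n r 2 (List (Line 2))} {V : Fin n → Fin r → Prop}
  {v : Fin n × Fin r}

/-- Prisoner `p` has completed round `k` of the algorithm of the non-leaders. -/
def HasIndicated (k : ℕ) (p : Fin n) (S : Snapshot n r 2 (List (Line 2))) : Prop :=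
  (S.memory p).length ≤ (otherMem n r (k + 1) (2 * n)).length

theorem not_hasIndicated {w : ℕ} (hk : k + 1 < r) (h : S.memory p = otherMem n r k w) :
    ¬ HasIndicated k p S := by
  rw [HasIndicated, h, not_le]
  exact length_otherMem_succ_lt w hk

theorem hasIndicated {w : ℕ} (hw : w ≤ 2 * n) (h : S.memory p = otherMem n r (k + 1) w) :
    HasIndicated k p S := by
  rw [HasIndicated, h]
  exact length_otherMem_le hw

/-- The set `F` is only known to exist at each time separately. The length of the remaining program
expresses membership through the state alone, so that different times can be compared. -/
theorem Counting.hasIndicated_iff (h : Counting ℓ k D A m F e S V) (hp : p ≠ ℓ) :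
    HasIndicated k p S ↔ p ∈ F := by
  constructor
  · intro hi
    by_contra hF
    obtain ⟨w, -, hm, -⟩ := h.fresh p hp hF
    exact not_hasIndicated h.lt hm hi
  · intro hF
    obtain ⟨w, -, hw, hm⟩ := h.flipped p hF
    exact hasIndicated hw hm

theorem Counting.hasIndicated_visit (h : Counting ℓ k D A m F e S V) (hp : p ≠ ℓ)
    (hi : HasIndicated k p S) : HasIndicated k p (S.visit (protocol n r ℓ) v) := by
  by_cases hv : p = v.1
  · subst hv
    obtain ⟨w, -, hw, hm⟩ := (h.step_flipped (ρ := v.2) ((h.hasIndicated_iff hp).1 hi)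
      (fun _ _ => id)).flipped v.1 ((h.hasIndicated_iff hp).1 hi)
    exact hasIndicated hw hm
  · rwa [HasIndicated, visit_memory_of_ne hv]

/-- In a phase, the reconfigurations by a non-leader are what his `indicate` line does. -/
theorem Counting.reconfigures_spec (h : Counting ℓ k D A m F e S V) (hp : p ≠ ℓ)
    (hne : (S.visit (protocol n r ℓ) (p, ρ)).room ρ ≠ S.room ρ) :
    p ∉ F ∧ S.memory p = otherMem n r k 0 ∧ ρ = A ∧ S.room A = up ∧
      (S.visit (protocol n r ℓ) (p, ρ)).room A = mark k ∧
      (S.visit (protocol n r ℓ) (p, ρ)).memory p = otherMem n r (k + 1) (2 * n) := by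
  by_cases hF : p ∈ F
  · obtain ⟨w, hw, -, hm⟩ := h.flipped p hF
    have := (room_visit_other ℓ hm hne).2.1
    have := h.three_le hw
    omega
  · obtain ⟨w, hw, hm, -⟩ := h.fresh p hp hF
    obtain ⟨-, rfl, hup, hv⟩ := room_visit_other ℓ hm hne
    obtain ⟨rfl, -⟩ := h.eq_of_up hup
    simp [hF, hm, hup, hv]

/-- This puts a reconfiguration by `p` in the form of a gain, as `existsUnique_gain` requires. -/
theorem Counting.reconfigures_iff (h : Counting ℓ k D A m F e S V) (hp : p ≠ ℓ) :
    (v.1 = p ∧ (S.visit (protocol n r ℓ) v).room v.2 ≠ S.room v.2) ↔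
      ¬ HasIndicated k p S ∧ HasIndicated k p (S.visit (protocol n r ℓ) v) := by
  constructor
  · rintro ⟨rfl, hne⟩
    obtain ⟨hF, -, -, -, -, hm⟩ := h.reconfigures_spec hp hne
    exact ⟨fun hi => hF ((h.hasIndicated_iff hp).1 hi), hasIndicated le_rfl hm⟩
  · rintro ⟨h1, h2⟩
    have hv : p = v.1 := by
      by_contra hv
      rw [HasIndicated, visit_memory_of_ne hv] at h2
      exact h1 h2
    subst hv
    refine ⟨rfl, ?_⟩
    obtain ⟨w, -, hm, -⟩ := h.fresh v.1 hp (fun hF => h1 ((h.hasIndicated_iff hp).2 hF))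
    rcases visit_other_cases ℓ hm v.2 with hc | ⟨-, -, hup, hc⟩ | ⟨-, w', -, -, hc⟩
    · rw [hc] at h2; exact absurd h2 h1
    · rw [hc, hup]
      simp [mark_ne_up]
    · exact absurd h2 (not_hasIndicated (w := w') h.lt (by rw [hc]; simp))

theorem Ready.visitor_eq (h : Ready ℓ k D S V)
    (hne : (S.visit (protocol n r ℓ) v).room v.2 ≠ S.room v.2) : v.1 = ℓ := by
  by_contra hp
  obtain ⟨w, -, -, hm⟩ := h.other v.1 hp
  exact h.room_ne_up _ (room_visit_other ℓ hm hne).2.2.1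

theorem Transit.visitor_eq (h : Transit ℓ k D I S V)
    (hne : (S.visit (protocol n r ℓ) v).room v.2 ≠ S.room v.2) : v.1 = ℓ := by
  by_contra hp
  obtain ⟨w, -, -, hm⟩ := h.other v.1 hp
  exact h.room_ne_up _ (room_visit_other ℓ hm hne).2.2.1

/-- In a transition all reconfigurations are from `idle k` to `mark k`. -/
theorem Transit.reconfigures_spec (h : Transit ℓ k D I S V) (hI : I.Nonempty)
    (hne : (S.visit (protocol n r ℓ) v).room v.2 ≠ S.room v.2) :
    S.room v.2 = idle k ∧ (S.visit (protocol n r ℓ) v).room v.2 = mark k := by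
  have hp := h.visitor_eq hne
  obtain ⟨p, ρ⟩ := v
  obtain rfl : p = ℓ := hp
  have hl := h.leader
  obtain ⟨c, hc⟩ : ∃ c, I.card = c + 1 := ⟨I.card - 1, by have := hI.card_pos; omega⟩
  rw [leaderTransition, hc, List.replicate_succ, List.cons_append] at hl
  by_cases hρ : S.room ρ = idle k
  · rw [visit_flip hl hρ]
    exact ⟨hρ, by simp⟩
  · rw [visit_flip_of_ne hl hρ] at hne
    exact absurd rfl hne

theorem Transit.reconfigures_iff (h : Transit ℓ k D I S V) (hI : I.Nonempty) :
    (v.2 = ρ ∧ (S.visit (protocol n r ℓ) v).room v.2 ≠ S.room v.2) ↔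
      S.room ρ ≠ mark k ∧ (S.visit (protocol n r ℓ) v).room ρ = mark k := by
  constructor
  · rintro ⟨rfl, hne⟩
    obtain ⟨h1, h2⟩ := h.reconfigures_spec hI hne
    exact ⟨h1 ▸ idle_ne_mark k, h2⟩
  · rintro ⟨h1, h2⟩
    have hv : ρ = v.2 := by
      by_contra hv
      rw [visit_room_of_ne hv] at h2
      exact h1 h2
    subst hv
    exact ⟨rfl, by rw [h2]; exact h1.symm⟩

theorem Transit.mark_visit (h : Transit ℓ k D I S V) (hI : I.Nonempty) (hρ : S.room ρ = mark k) :
    (S.visit (protocol n r ℓ) v).room ρ = mark k := by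
  by_contra hne
  have hv : ρ = v.2 := by
    by_contra hv
    rw [visit_room_of_ne hv] at hne
    exact hne hρ
  subst hv
  exact hne (h.reconfigures_spec hI (by rwa [hρ])).2

end Reconfiguration

/-! ### Times -/

/-- Prisoner `p` has been in room `ρ` during the first `t` visits. -/
def Visited {n r : ℕ} (σ : Schedule n r) (t : ℕ) (p : Fin n) (ρ : Fin r) : Prop :=
  ∃ u < t, σ u = (p, ρ)

theorem Visited.succ {n r : ℕ} {σ : Schedule n r} {t : ℕ} {p : Fin n} {ρ : Fin r}
    (h : Visited σ t p ρ) : Visited σ (t + 1) p ρ := by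
  obtain ⟨u, hu, h⟩ := h
  exact ⟨u, by omega, h⟩

theorem visited_succ_self {n r : ℕ} (σ : Schedule n r) (t : ℕ) :
    Visited σ (t + 1) (σ t).1 (σ t).2 :=
  ⟨t, by omega, rfl⟩

/-- A property which is left only for `Q` and does not last forever is left for `Q`. -/
theorem exists_exit {P Q : ℕ → Prop} {a N : ℕ} (ha : P a)
    (hstep : ∀ t, P t → P (t + 1) ∨ Q (t + 1)) (hN : ∀ t, N ≤ t → ¬ P t) :
    ∃ b, a < b ∧ Q b ∧ ∀ t, a ≤ t → t < b → P t := by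
  classical
  -- The time `a + N` is not before `N`, however `a` and `N` compare.
  have hex : ∃ d, ¬ P (a + d) := ⟨N, hN _ (by omega)⟩
  have h1 := Nat.find_spec hex
  have h2 : ∀ t, a ≤ t → t < a + Nat.find hex → P t := by
    intro t h h'
    have := Nat.find_min hex (m := t - a) (by omega)
    rwa [not_not, show a + (t - a) = t by omega] at this
  rcases hd : Nat.find hex with _ | d
  · rw [hd] at h1; exact absurd ha h1
  · rw [hd] at h1 h2
    refine ⟨a + (d + 1), by omega, ?_, h2⟩
    exact (hstep (a + d) (h2 _ (by omega) (by omega))).resolve_left h1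

/-- A property which does not get lost is gained exactly once. -/
theorem existsUnique_gain {f : ℕ → Prop} {a b : ℕ} (hab : a ≤ b) (ha : ¬ f a) (hb : f b)
    (hstep : ∀ t, a ≤ t → t < b → f t → f (t + 1)) :
    ∃! t, (a ≤ t ∧ t < b) ∧ ¬ f t ∧ f (t + 1) := by
  have mono : ∀ s t, a ≤ s → s ≤ t → t ≤ b → f s → f t := by
    intro s t hs hst
    induction t, hst using Nat.le_induction with
    | base => exact fun _ h => h
    | succ t hst ih => exact fun ht h => hstep t (by omega) (by omega) (ih (by omega) h)
  obtain ⟨t, h1, h2, h3⟩ : ∃ t, (a ≤ t ∧ t < b) ∧ ¬ f t ∧ f (t + 1) := by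
    by_contra! hc
    have : ∀ t, a ≤ t → t ≤ b → ¬ f t := by
      intro t hat
      induction t, hat using Nat.le_induction with
      | base => exact fun _ => ha
      | succ t hat ih => exact fun ht => hc t ⟨hat, by omega⟩ (ih (by omega))
    exact this b hab le_rfl hb
  refine ⟨t, ⟨h1, h2, h3⟩, ?_⟩
  rintro u ⟨h4, h5, h6⟩
  by_contra hne
  rcases Nat.lt_or_gt_of_ne hne with h | h
  · exact h2 (mono (u + 1) t (by omega) (by omega) (by omega) h6)
  · exact h5 (mono (t + 1) u (by omega) (by omega) (by omega) h3)

/-- Round `k` takes place from time `a` to time `d`; its active room is `A`, its phase is from `b`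
to `c`, and `D` is the set of rooms that are done before. -/
structure RoundSpec {n r : ℕ} (ℓ : Fin n) (σ : Schedule n r) (k : ℕ) (D : Finset (Fin r))
    (A : Fin r) (a b c d : ℕ) : Prop where
  start_lt : a < b
  phase_lt : b < c
  transit_lt : c < d
  ready : ∀ t, a ≤ t → t < b → Ready ℓ k D (run (protocol n r ℓ) σ t) (Visited σ t)
  phase_start : Counting ℓ k D A (n - 2) ∅ 0 (run (protocol n r ℓ) σ b) (Visited σ b)
  counting : ∀ t, b ≤ t → t < c →
    ∃ m F e, Counting ℓ k D A m F e (run (protocol n r ℓ) σ t) (Visited σ t)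
  transit_start :
    Transit ℓ k (insert A D) (insert A D)ᶜ (run (protocol n r ℓ) σ c) (Visited σ c)
  transit : ∀ t, c ≤ t → t < d → ∃ I : Finset (Fin r), I.Nonempty ∧
    Transit ℓ k (insert A D) I (run (protocol n r ℓ) σ t) (Visited σ t)
  finish : Ready ℓ (k + 1) (insert A D) (run (protocol n r ℓ) σ d) (Visited σ d)

theorem exists_roundSpec {n r : ℕ} (hn : 2 ≤ n) {ℓ : Fin n} {σ : Schedule n r} (hσ : σ.Valid)
    {k : ℕ} (hk : k + 1 < r) {D : Finset (Fin r)} {a : ℕ}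
    (ha : Ready ℓ k D (run (protocol n r ℓ) σ a) (Visited σ a)) :
    ∃ A b c d, RoundSpec ℓ σ k D A a b c d := by
  obtain ⟨N, hN⟩ := exists_run_fixed ℓ hσ
  obtain ⟨b, hab, ⟨A, hb⟩, hready⟩ := exists_exit
    (P := fun t => Ready ℓ k D (run (protocol n r ℓ) σ t) (Visited σ t))
    (Q := fun t => ∃ A, Counting ℓ k D A (n - 2) ∅ 0 (run (protocol n r ℓ) σ t) (Visited σ t))
    ha (fun t ht => ht.step hn hk (fun _ _ => Visited.succ) (visited_succ_self σ t))
    (fun t ht h => by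
      obtain ⟨v, hv⟩ := h.exists_visit_ne hk
      exact hv (hN t ht v))
  obtain ⟨c, hbc, hc, hcounting⟩ := exists_exit
    (P := fun t => ∃ m F e, Counting ℓ k D A m F e (run (protocol n r ℓ) σ t) (Visited σ t))
    (Q := fun t => Transit ℓ k (insert A D) (insert A D)ᶜ (run (protocol n r ℓ) σ t)
      (Visited σ t))
    ⟨_, _, _, hb⟩
    (fun t ht => by
      obtain ⟨m, F, e, ht⟩ := ht
      exact ht.step (fun _ _ => Visited.succ) (visited_succ_self σ t))
    (fun t ht h => by
      obtain ⟨m, F, e, h⟩ := h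
      obtain ⟨v, hv⟩ := h.exists_visit_ne
      exact hv (hN t ht v))
  have hne : ((insert A D)ᶜ : Finset (Fin r)).Nonempty := by
    obtain ⟨ρ, hρ⟩ := exists_notMem_of_card_lt (s := insert A D) (by rw [hc.card_done]; exact hk)
    exact ⟨ρ, Finset.mem_compl.2 hρ⟩
  obtain ⟨d, hcd, hd, htransit⟩ := exists_exit
    (P := fun t => ∃ I : Finset (Fin r), I.Nonempty ∧
      Transit ℓ k (insert A D) I (run (protocol n r ℓ) σ t) (Visited σ t))
    (Q := fun t => Transit ℓ k (insert A D) ∅ (run (protocol n r ℓ) σ t) (Visited σ t))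
    ⟨_, hne, hc⟩
    (fun t ht => by
      obtain ⟨I, hI, ht⟩ := ht
      obtain ⟨I', h'⟩ := ht.step hI (v := σ t) (fun _ _ => Visited.succ) (visited_succ_self σ t)
      rcases I'.eq_empty_or_nonempty with rfl | hI'
      · exact Or.inr h'
      · exact Or.inl ⟨I', hI', h'⟩)
    (fun t ht h => by
      obtain ⟨I, hI, h⟩ := h
      obtain ⟨v, hv⟩ := h.exists_visit_ne hI
      exact hv (hN t ht v))
  exact ⟨A, b, c, d, hab, hbc, hcd, hready, hb, hcounting, hc, htransit, hd.ready⟩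

/-- The active rooms, and the times at which the rounds, their phases and their transitions
begin. -/
structure Timeline {n r : ℕ} (ℓ : Fin n) (σ : Schedule n r) (j : ℕ) (act : ℕ → Fin r)
    (T₀ T₁ T₂ : ℕ → ℕ) : Prop where
  zero : T₀ 0 = 0
  round : ∀ k < j, RoundSpec ℓ σ k ((Finset.range k).image act) (act k) (T₀ k) (T₁ k) (T₂ k)
    (T₀ (k + 1))
  ready : Ready ℓ j ((Finset.range j).image act) (run (protocol n r ℓ) σ (T₀ j)) (Visited σ (T₀ j))

theorem exists_timeline {n r : ℕ} (hn : 2 ≤ n) (hr : 2 ≤ r) (ℓ : Fin n) {σ : Schedule n r}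
    (hσ : σ.Valid) {j : ℕ} (hj : j < r) : ∃ act T₀ T₁ T₂, Timeline ℓ σ j act T₀ T₁ T₂ := by
  induction j with
  | zero =>
    -- Only `T₀ 0 = 0` matters; the other values are placeholders, overwritten round by round.
    refine ⟨fun _ => ⟨0, by omega⟩, fun _ => 0, fun _ => 0, fun _ => 0, rfl, by simp, ?_⟩
    refine ⟨by simp, ?_, by simp, ?_, ?_, by simp, by omega⟩
    · simp [run, protocol, Strategy.ofProgram, leaderProgram_eq hr]
    · intro ρ _
      ext i
      fin_cases i <;> simp [run, idle, c0]
    · intro p hp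
      -- Two prisoners suffice for `3 ≤ 2 * n`.
      exact ⟨2 * n, by omega, le_rfl,
        by simp [run, protocol, Strategy.ofProgram, hp, otherProgram_eq hr]⟩
  | succ j ih =>
    obtain ⟨act, T₀, T₁, T₂, h⟩ := ih (by omega)
    obtain ⟨A, b, c, d, hspec⟩ := exists_roundSpec hn hσ hj h.ready
    have himage (k : ℕ) (hk : k ≤ j) :
        (Finset.range k).image (Function.update act j A) = (Finset.range k).image act := by
      apply Finset.image_congr
      intro i hi
      have : i ≠ j := by
        have := Finset.mem_range.1 (Finset.mem_coe.1 hi)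
        omega
      simp [this]
    refine ⟨Function.update act j A, Function.update T₀ (j + 1) d, Function.update T₁ j b,
      Function.update T₂ j c, by simp [h.zero], ?_, ?_⟩
    · intro k hk
      rw [himage k (by omega)]
      by_cases hkj : k = j
      · subst hkj
        simpa using hspec
      · have h1 : k ≠ j + 1 := by omega
        simpa [hkj, h1] using h.round k (by omega)
    · rw [Finset.range_add_one, Finset.image_insert, himage j le_rfl]
      simpa using hspec.finish

/-! ### Stages recognized by the leader's current line, and their consequences for a whole schedule
-/

section Timeline

variable {n r : ℕ} {ℓ : Fin n} {σ : Schedule n r} {act : ℕ → Fin r} {T₀ T₁ T₂ : ℕ → ℕ}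
  {k t : ℕ}

theorem AtPart.unique {p : Fin n} {i j : Part} (hi : AtPart ℓ σ t p i) (hj : AtPart ℓ σ t p j) :
    i = j := by
  obtain ⟨c, rest, h⟩ := hi
  obtain ⟨c', rest', h'⟩ := hj
  rw [h] at h'
  simp only [List.cons.injEq, Line.mk.injEq] at h'
  exact h'.1.2

theorem Ready.atPart {D : Finset (Fin r)} {V : Fin n → Fin r → Prop}
    (h : Ready ℓ k D (run (protocol n r ℓ) σ t) V) (hk : k + 1 < r) :
    AtPart ℓ σ t ℓ (.ready k) :=
  ⟨_, _, h.leader.trans (leaderFrom_of_lt hk)⟩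

theorem Ready.atPart_final {D : Finset (Fin r)} {V : Fin n → Fin r → Prop}
    (h : Ready ℓ k D (run (protocol n r ℓ) σ t) V) (hk : r ≤ k + 1) :
    AtPart ℓ σ t ℓ .final :=
  ⟨_, _, h.leader.trans (leaderFrom_last hk)⟩

theorem Counting.atPart {D : Finset (Fin r)} {A : Fin r} {m e : ℕ} {F : Finset (Fin n)}
    {V : Fin n → Fin r → Prop} (h : Counting ℓ k D A m F e (run (protocol n r ℓ) σ t) V) :
    AtPart ℓ σ t ℓ (.active k) := by
  rcases m with _ | m
  · exact ⟨_, _, h.leader⟩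
  · exact ⟨_, _, h.leader⟩

theorem Transit.atPart {D I : Finset (Fin r)} {V : Fin n → Fin r → Prop}
    (h : Transit ℓ k D I (run (protocol n r ℓ) σ t) V) (hI : I.Nonempty) :
    AtPart ℓ σ t ℓ (.transition k) := by
  obtain ⟨c, hc⟩ : ∃ c, I.card = c + 1 := ⟨I.card - 1, by have := hI.card_pos; omega⟩
  have hl := h.leader
  rw [hc] at hl
  exact ⟨_, _, hl⟩

/-- The leader is at `declare` and the other programs are exhausted, so nothing changes any more. -/
theorem Timeline.ready_of_le (h : Timeline ℓ σ (r - 1) act T₀ T₁ T₂) (ht : T₀ (r - 1) ≤ t) :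
    Ready ℓ (r - 1) ((Finset.range (r - 1)).image act) (run (protocol n r ℓ) σ t)
      (Visited σ t) := by
  induction t, ht using Nat.le_induction with
  | base => exact h.ready
  | succ t _ ih =>
    have : run (protocol n r ℓ) σ (t + 1) = run (protocol n r ℓ) σ t := by
      by_cases hp : (σ t).1 = ℓ
      · have hl : (run (protocol n r ℓ) σ t).memory (σ t).1 = _ :=
          (congrArg _ hp).trans (ih.leader.trans (leaderFrom_last (by omega)))
        exact visit_declare hl
      · obtain ⟨w, -, -, hm⟩ := ih.other _ hp
        rw [otherMem_of_le _ (by omega)] at hm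
        exact visit_nil hm
    rw [this]
    exact ih.mono fun _ _ => Visited.succ

theorem Timeline.cases {j : ℕ} (h : Timeline ℓ σ j act T₀ T₁ T₂) (t : ℕ) :
    (∃ k < j, T₀ k ≤ t ∧ t < T₁ k) ∨ (∃ k < j, T₁ k ≤ t ∧ t < T₂ k) ∨
      (∃ k < j, T₂ k ≤ t ∧ t < T₀ (k + 1)) ∨ T₀ j ≤ t := by
  by_cases hj : T₀ j ≤ t
  · exact Or.inr (Or.inr (Or.inr hj))
  have hex : ∃ i, t < T₀ i := ⟨j, not_le.1 hj⟩
  have h1 := Nat.find_spec hex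
  have h2 := Nat.find_min' hex (not_le.1 hj)
  rcases hi : Nat.find hex with _ | k
  · rw [hi, h.zero] at h1; omega
  · have h3 := Nat.find_min hex (m := k) (by omega)
    rw [hi] at h1 h2
    have hk : k < j := by omega
    by_cases h4 : t < T₁ k
    · exact Or.inl ⟨k, hk, not_lt.1 h3, h4⟩
    by_cases h5 : t < T₂ k
    · exact Or.inr (Or.inl ⟨k, hk, not_lt.1 h4, h5⟩)
    · exact Or.inr (Or.inr (Or.inl ⟨k, hk, not_lt.1 h5, h1⟩))

/-- The stages cover all times, and the leader's line carries a different comment in each stage of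
each round. -/
theorem Timeline.atPart_active_iff (h : Timeline ℓ σ (r - 1) act T₀ T₁ T₂) (hk : k < r - 1) :
    AtPart ℓ σ t ℓ (.active k) ↔ T₁ k ≤ t ∧ t < T₂ k := by
  constructor
  · intro ha
    rcases h.cases t with ⟨i, hi, h1, h2⟩ | ⟨i, hi, h1, h2⟩ | ⟨i, hi, h1, h2⟩ | h1
    · cases ha.unique (((h.round i hi).ready t h1 h2).atPart (by omega))
    · obtain ⟨m, F, e, hc⟩ := (h.round i hi).counting t h1 h2
      cases ha.unique hc.atPart
      exact ⟨h1, h2⟩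
    · obtain ⟨I, hI, hc⟩ := (h.round i hi).transit t h1 h2
      cases ha.unique (hc.atPart hI)
    · cases ha.unique ((h.ready_of_le h1).atPart_final (by omega))
  · rintro ⟨h1, h2⟩
    obtain ⟨m, F, e, hc⟩ := (h.round k hk).counting t h1 h2
    exact hc.atPart

theorem Timeline.atPart_transition_iff (h : Timeline ℓ σ (r - 1) act T₀ T₁ T₂) (hk : k < r - 1) :
    AtPart ℓ σ t ℓ (.transition k) ↔ T₂ k ≤ t ∧ t < T₀ (k + 1) := by
  constructor
  · intro ha
    rcases h.cases t with ⟨i, hi, h1, h2⟩ | ⟨i, hi, h1, h2⟩ | ⟨i, hi, h1, h2⟩ | h1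
    · cases ha.unique (((h.round i hi).ready t h1 h2).atPart (by omega))
    · obtain ⟨m, F, e, hc⟩ := (h.round i hi).counting t h1 h2
      cases ha.unique hc.atPart
    · obtain ⟨I, hI, hc⟩ := (h.round i hi).transit t h1 h2
      cases ha.unique (hc.atPart hI)
      exact ⟨h1, h2⟩
    · cases ha.unique ((h.ready_of_le h1).atPart_final (by omega))
  · rintro ⟨h1, h2⟩
    obtain ⟨I, hI, hc⟩ := (h.round k hk).transit t h1 h2
    exact hc.atPart hI

theorem Timeline.act_ne (h : Timeline ℓ σ (r - 1) act T₀ T₁ T₂) {i : ℕ} (hk : k < r - 1)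
    (hi : i < k) : act i ≠ act k := fun he =>
  (h.round k hk).phase_start.active_notMem
    (he ▸ Finset.mem_image_of_mem act (Finset.mem_range.2 hi))

/-- Nobody declares before the last round is over. -/
theorem Timeline.not_declares (h : Timeline ℓ σ (r - 1) act T₀ T₁ T₂) (ht : t < T₀ (r - 1))
    (p : Fin n) : ¬ (protocol n r ℓ p).Declares ((run (protocol n r ℓ) σ t).memory p) := by
  have hother : ∀ k w, (run (protocol n r ℓ) σ t).memory p = otherMem n r k w →
      ¬ (protocol n r ℓ p).Declares ((run (protocol n r ℓ) σ t).memory p) := by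
    rintro k w hm ⟨i, rest, hd⟩
    rw [hm] at hd
    by_cases hk : k + 1 < r
    · rcases w with _ | w
      · simp [otherMem_zero hk] at hd
      · simp [otherMem_succ w hk] at hd
    · simp [otherMem_of_le w (not_lt.1 hk)] at hd
  rcases h.cases t with ⟨k, hk, h1, h2⟩ | ⟨k, hk, h1, h2⟩ | ⟨k, hk, h1, h2⟩ | h1
  · have hc := (h.round k hk).ready t h1 h2
    by_cases hp : p = ℓ
    · subst hp
      rintro ⟨i, rest, hd⟩
      simp [hc.leader, leaderFrom_of_lt (show k + 1 < r by omega)] at hd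
    · obtain ⟨w, -, -, hm⟩ := hc.other p hp
      exact hother _ _ hm
  · obtain ⟨m, F, e, hc⟩ := (h.round k hk).counting t h1 h2
    by_cases hp : p = ℓ
    · subst hp
      rintro ⟨i, rest, hd⟩
      rcases m with _ | m <;> simp [hc.leader, leaderActive, List.replicate_succ] at hd
    · by_cases hF : p ∈ F
      · obtain ⟨w, -, -, hm⟩ := hc.flipped p hF
        exact hother _ _ hm
      · obtain ⟨w, -, hm, -⟩ := hc.fresh p hp hF
        exact hother _ _ hm
  · obtain ⟨I, hI, hc⟩ := (h.round k hk).transit t h1 h2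
    by_cases hp : p = ℓ
    · subst hp
      obtain ⟨c, hcard⟩ : ∃ c, I.card = c + 1 := ⟨I.card - 1, by have := hI.card_pos; omega⟩
      rintro ⟨i, rest, hd⟩
      simp [hc.leader, hcard, leaderTransition, List.replicate_succ] at hd
    · obtain ⟨w, -, -, hm⟩ := hc.other p hp
      exact hother _ _ hm
  · omega

theorem winning_protocol (hn : 2 ≤ n) (hr : 2 ≤ r) (ℓ : Fin n) : Winning (protocol n r ℓ) r := by
  intro σ hσ
  obtain ⟨act, T₀, T₁, T₂, h⟩ := exists_timeline hn hr ℓ hσ (j := r - 1) (by omega)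
  refine ⟨T₀ (r - 1), ⟨ℓ, .final, [], ?_⟩, fun u hu p => h.not_declares hu p,
    h.ready.seen_all (by omega)⟩
  rw [h.ready.leader, leaderFrom_last (by omega)]

theorem Timeline.rooms_in_phase (h : Timeline ℓ σ (r - 1) act T₀ T₁ T₂) (hk : k < r - 1)
    (ht : AtPart ℓ σ t ℓ (.active k)) :
    ∃ m F e, Counting ℓ k ((Finset.range k).image act) (act k) m F e
      (run (protocol n r ℓ) σ t) (Visited σ t) := by
  obtain ⟨h1, h2⟩ := (h.atPart_active_iff hk).1 ht
  exact (h.round k hk).counting t h1 h2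

/-- `HasIndicated` fails when the phase starts with `F = ∅`, holds when the transition starts, and
is never lost in between. -/
theorem Timeline.existsUnique_indication (h : Timeline ℓ σ (r - 1) act T₀ T₁ T₂)
    (hk : k < r - 1) {p : Fin n} (hp : p ≠ ℓ) :
    ∃! t : ℕ, AtPart ℓ σ t ℓ (.active k) ∧ (σ t).1 = p ∧
      Reconfigures (protocol n r ℓ) σ t := by
  have hround := h.round k hk
  have key := existsUnique_gain (f := fun t => HasIndicated k p (run (protocol n r ℓ) σ t))
    (a := T₁ k) (b := T₂ k) hround.phase_lt.le
    (by simp [hround.phase_start.hasIndicated_iff hp])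
    (by
      obtain ⟨w, -, hw, hm⟩ := hround.transit_start.other p hp
      exact hasIndicated hw hm)
    (fun t h1 h2 hi => by
      obtain ⟨m, F, e, hc⟩ := hround.counting t h1 h2
      exact hc.hasIndicated_visit hp hi)
  refine (existsUnique_congr fun t => ?_).1 key
  rw [h.atPart_active_iff hk]
  refine and_congr_right fun ⟨h1, h2⟩ => ?_
  obtain ⟨m, F, e, hc⟩ := hround.counting t h1 h2
  exact (hc.reconfigures_iff hp).symm

theorem Timeline.existsUnique_transition (h : Timeline ℓ σ (r - 1) act T₀ T₁ T₂)
    (hk : k < r - 1) {ρ : Fin r} (hρ : ρ ∉ insert (act k) ((Finset.range k).image act)) :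
    ∃! t : ℕ, AtPart ℓ σ t ℓ (.transition k) ∧ (σ t).2 = ρ ∧
      Reconfigures (protocol n r ℓ) σ t := by
  have hround := h.round k hk
  have key := existsUnique_gain (f := fun t => (run (protocol n r ℓ) σ t).room ρ = mark k)
    (a := T₂ k) (b := T₀ (k + 1)) hround.transit_lt.le
    (by
      rw [hround.transit_start.room_idle ρ (Finset.mem_compl.2 hρ)]
      exact idle_ne_mark k)
    (by rw [hround.finish.room_idle ρ hρ, idle_succ])
    (fun t h1 h2 hi => by
      obtain ⟨I, hI, hc⟩ := hround.transit t h1 h2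
      exact hc.mark_visit hI hi)
  refine (existsUnique_congr fun t => ?_).1 key
  rw [h.atPart_transition_iff hk]
  refine and_congr_right fun ⟨h1, h2⟩ => ?_
  obtain ⟨I, hI, hc⟩ := hround.transit t h1 h2
  exact (hc.reconfigures_iff hI).symm

theorem Timeline.visitor_eq (h : Timeline ℓ σ (r - 1) act T₀ T₁ T₂)
    (ht : ∀ k < r - 1, ¬ AtPart ℓ σ t ℓ (.active k)) (hne : Reconfigures (protocol n r ℓ) σ t) :
    (σ t).1 = ℓ := by
  rcases h.cases t with ⟨k, hk, h1, h2⟩ | ⟨k, hk, h1, h2⟩ | ⟨k, hk, h1, h2⟩ | h1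
  · exact ((h.round k hk).ready t h1 h2).visitor_eq hne
  · exact absurd ((h.atPart_active_iff hk).2 ⟨h1, h2⟩) (ht k hk)
  · obtain ⟨I, -, hc⟩ := (h.round k hk).transit t h1 h2
    exact hc.visitor_eq hne
  · exact (h.ready_of_le h1).visitor_eq hne

theorem Timeline.visited_of_done (h : Timeline ℓ σ (r - 1) act T₀ T₁ T₂) {ρ : Fin r}
    (hρ : (run (protocol n r ℓ) σ t).room ρ = done) (p : Fin n) : Visited σ t p ρ := by
  rcases h.cases t with ⟨k, hk, h1, h2⟩ | ⟨k, hk, h1, h2⟩ | ⟨k, hk, h1, h2⟩ | h1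
  · have hc := (h.round k hk).ready t h1 h2
    exact hc.seen_done ρ (hc.mem_of_done hρ) p
  · obtain ⟨m, F, e, hc⟩ := (h.round k hk).counting t h1 h2
    exact hc.seen_done ρ (hc.mem_of_done hρ) p
  · obtain ⟨I, -, hc⟩ := (h.round k hk).transit t h1 h2
    exact hc.seen_done ρ (hc.mem_of_done hρ) p
  · have hc := h.ready_of_le h1
    exact hc.seen_done ρ (hc.mem_of_done hρ) p

/-- In a phase no non-leader is about to make the flip of the other kind of phase. -/
theorem Counting.not_atCommand {D : Finset (Fin r)} {A : Fin r} {m e : ℕ} {F : Finset (Fin n)}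
    {V : Fin n → Fin r → Prop} (h : Counting ℓ k D A m F e (run (protocol n r ℓ) σ t) V)
    {p : Fin n} (hp : p ≠ ℓ) : ¬ AtCommand ℓ σ t p (.flip up (idle k)) := by
  rintro ⟨i, rest, hd⟩
  by_cases hF : p ∈ F
  · obtain ⟨w, h1, -, hm⟩ := h.flipped p hF
    have hw := h.three_le h1
    obtain ⟨w, rfl⟩ : ∃ w', w = w' + 1 := ⟨w - 1, by omega⟩
    by_cases hk : k + 1 + 1 < r
    · simp [hm, otherMem_succ w hk] at hd
    · simp [hm, otherMem_of_le _ (not_lt.1 hk)] at hd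
  · obtain ⟨w, -, hm, -⟩ := h.fresh p hp hF
    rcases w with _ | w
    · simp [hm, otherMem_zero h.lt, (idle_ne_mark k).symm] at hd
    · simp [hm, otherMem_succ w h.lt] at hd

end Timeline

end Prisoners

/-! ### The main theorem, read off the timeline -/

open Prisoners in
theorem mainTheorem5 (n r : ℕ) (hn : 2 ≤ n) (hr : 2 ≤ r) (ℓ : Fin n) :
    -- the protocol wins
    Winning (protocol n r ℓ) r ∧
    -- it handles the rooms one at a time: `act k` is the active room of round `k`
    ∀ σ : Schedule n r, σ.Valid → ∃ act : Fin (r - 1) → Fin r, Function.Injective act ∧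
      -- the rooms during the phase of round `k`
      (∀ (k : Fin (r - 1)) (t : ℕ), AtPart ℓ σ t ℓ (.active k) →
        ((run (protocol n r ℓ) σ t).room (act k) = mark k ∨
          (run (protocol n r ℓ) σ t).room (act k) = up) ∧
        (∀ j < k, (run (protocol n r ℓ) σ t).room (act j) = done) ∧
        (∀ ρ, (∀ j ≤ k, ρ ≠ act j) → (run (protocol n r ℓ) σ t).room ρ = idle k)) ∧
      -- the active room is in configuration `up` when the phase starts
      (∀ (k : Fin (r - 1)) (t : ℕ), ¬ AtPart ℓ σ t ℓ (.active k) →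
        AtPart ℓ σ (t + 1) ℓ (.active k) →
        (run (protocol n r ℓ) σ (t + 1)).room (act k) = up) ∧
      -- in a phase no non-leader is about to make the flip that belongs to the other kind of phase
      (∀ (k : Fin (r - 1)) (t : ℕ), AtPart ℓ σ t ℓ (.active k) →
        ∀ p, p ≠ ℓ → ¬ AtCommand ℓ σ t p (.flip up (idle k))) ∧
      -- in each phase each non-leader reconfigures exactly one room exactly once, namely the
      -- active room, from `up` to `mark k`, and he does so by the command meant for round `k`
      (∀ (k : Fin (r - 1)) (p : Fin n), p ≠ ℓ →
        (∃! t : ℕ, AtPart ℓ σ t ℓ (.active k) ∧ (σ t).1 = p ∧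
          Reconfigures (protocol n r ℓ) σ t) ∧
        ∀ t : ℕ, AtPart ℓ σ t ℓ (.active k) → (σ t).1 = p →
          Reconfigures (protocol n r ℓ) σ t →
            AtPart ℓ σ t p (.indicate k) ∧
            (σ t).2 = act k ∧ (run (protocol n r ℓ) σ t).room (act k) = up ∧
            (run (protocol n r ℓ) σ (t + 1)).room (act k) = mark k) ∧
      -- outside the phases only the leader reconfigures rooms
      (∀ t : ℕ, (∀ k : Fin (r - 1), ¬ AtPart ℓ σ t ℓ (.active k)) →
        Reconfigures (protocol n r ℓ) σ t → (σ t).1 = ℓ) ∧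
      -- during the transition after round `k`, all rooms that have been active are done, and the
      -- leader reconfigures each other room once, from `idle k` to `mark k`
      (∀ (k : Fin (r - 1)) (t : ℕ), AtPart ℓ σ t ℓ (.transition k) →
        ∀ j ≤ k, (run (protocol n r ℓ) σ t).room (act j) = done) ∧
      (∀ (k : Fin (r - 1)) (ρ : Fin r), (∀ j ≤ k, ρ ≠ act j) →
        (∃! t : ℕ, AtPart ℓ σ t ℓ (.transition k) ∧ (σ t).2 = ρ ∧
          Reconfigures (protocol n r ℓ) σ t) ∧
        ∀ t : ℕ, AtPart ℓ σ t ℓ (.transition k) → (σ t).2 = ρ →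
          Reconfigures (protocol n r ℓ) σ t →
            (run (protocol n r ℓ) σ t).room ρ = idle k ∧
            (run (protocol n r ℓ) σ (t + 1)).room ρ = mark k) ∧
      -- a room in configuration `done` has been visited by all prisoners
      (∀ (t : ℕ) (ρ : Fin r), (run (protocol n r ℓ) σ t).room ρ = done →
        ∀ p, ∃ u < t, σ u = (p, ρ)) := by
  refine ⟨winning_protocol hn hr ℓ, fun σ hσ => ?_⟩
  obtain ⟨act, T₀, T₁, T₂, h⟩ := exists_timeline hn hr ℓ hσ (j := r - 1) (by omega)
  have hmem (k : Fin (r - 1)) (j : Fin (r - 1)) (hj : j < k) :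
      act j ∈ (Finset.range k).image act :=
    Finset.mem_image_of_mem act (Finset.mem_range.2 hj)
  have hmem_insert (k : Fin (r - 1)) (j : Fin (r - 1)) (hj : j ≤ k) :
      act j ∈ insert (act k) ((Finset.range k).image act) := by
    rcases hj.eq_or_lt with rfl | hj
    · exact Finset.mem_insert_self _ _
    · exact Finset.mem_insert_of_mem (hmem k j hj)
  have hnotMem (k : Fin (r - 1)) (ρ : Fin r) (hρ : ∀ j ≤ k, ρ ≠ act j) :
      ρ ∉ insert (act k) ((Finset.range k).image act) := by
    simp only [Finset.mem_insert, Finset.mem_image, Finset.mem_range, not_or, not_exists, not_and]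
    refine ⟨hρ k le_rfl, fun j hj he => ?_⟩
    exact hρ ⟨j, hj.trans k.2⟩ hj.le he.symm
  refine ⟨fun k => act k, ?_, ?_, ?_, ?_, ?_, ?_, ?_, ?_, ?_⟩
  · intro i j hij
    by_contra hne
    rcases lt_or_gt_of_ne hne with hlt | hlt
    · exact h.act_ne j.2 hlt hij
    · exact h.act_ne i.2 hlt hij.symm
  · intro k t ht
    obtain ⟨m, F, e, hc⟩ := h.rooms_in_phase k.2 ht
    refine ⟨?_, fun j hj => hc.room_done _ (hmem k j hj), fun ρ hρ => ?_⟩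
    · rcases hc.room_active with hA | hA
      · exact Or.inr hA.1
      · exact Or.inl hA.1
    · have := hnotMem k ρ hρ
      simp only [Finset.mem_insert, not_or] at this
      exact hc.room_idle ρ this.2 this.1
  · intro k t ht ht'
    rw [h.atPart_active_iff k.2] at ht ht'
    have hs := (h.round k k.2).phase_start
    -- The phase is an interval of times, so it can be entered only at `T₁ k`; there `e = 0`, which
    -- excludes `mark k`.
    rw [show T₁ k = t + 1 by omega] at hs
    rcases hs.room_active with hA | hA
    · exact hA.1
    · exact absurd hA.2 zero_ne_one
  · intro k t ht p hp
    obtain ⟨m, F, e, hc⟩ := h.rooms_in_phase k.2 ht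
    exact hc.not_atCommand hp
  · intro k p hp
    refine ⟨h.existsUnique_indication k.2 hp, fun t ht hpt hne => ?_⟩
    obtain ⟨m, F, e, hc⟩ := h.rooms_in_phase k.2 ht
    subst hpt
    obtain ⟨-, hm, hA, hup, hmark, -⟩ := hc.reconfigures_spec hp hne
    exact ⟨⟨_, _, hm.trans (otherMem_zero hc.lt)⟩, hA, hup, hmark⟩
  · exact fun t ht hne => h.visitor_eq (fun k hk => ht ⟨k, hk⟩) hne
  · intro k t ht j hj
    obtain ⟨h1, h2⟩ := (h.atPart_transition_iff k.2).1 ht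
    obtain ⟨I, -, hc⟩ := (h.round k k.2).transit t h1 h2
    exact hc.room_done _ (hmem_insert k j hj)
  · intro k ρ hρ
    refine ⟨h.existsUnique_transition k.2 (hnotMem k ρ hρ), ?_⟩
    rintro t ht rfl hne
    obtain ⟨h1, h2⟩ := (h.atPart_transition_iff k.2).1 ht
    obtain ⟨I, hI, hc⟩ := (h.round k k.2).transit t h1 h2
    exact hc.reconfigures_spec hI hne
  · exact fun t ρ hρ p => h.visited_of_done hρ p
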